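/- Let $0\le k\le n$, and fix an orientation of $\mathbb{R}^n$, with respect to which the Hodge star $\star$ is taken. There is a constant $C$ depending only on $n$ and $k$ such that the following holds. Let $K$ be a finite simplicial complex in $\mathbb{R}^n$ that is well-centered, i.e. the circumcenter $c(s)$ of every simplex $s$ of $K$ (of any dimension) lies in the relative interior of $s$. Let every simplex of $K$ be oriented, the $n$-simplices positively and the others arbitrarily. Let $h$ be the length of the longest edge of $K$, $\lvert K\rvert$ the union of the simplices of $K$, and $\lvert s\rvert$ the $j$-dimensional volume of a $j$-simplex $s$ (equal to $1$ for a vertex). Let $\sigma\in K$ be an $n$-simplex and let $\tau$ be a $k$-dimensional face of $\sigma$; let $\gamma_\tau$ be the radius of the largest $k$-dimensional ball contained in $\tau$ (with $\gamma_\tau^0=1$ if $k=0$). The circumcentric dual of $\tau$ is the chain $$\ast\tau=\sum_{\tau=\tau_k\prec\tau_{k+1}\prec\dots\prec\tau_n}\pm\,[c(\tau_k),c(\tau_{k+1}),\dots,c(\tau_n)],$$ where the sum runs over all flags of simplices $\tau_j\in K$ with $\dim\tau_j=j$, and the sign is $\operatorname{sign}([c(\tau_0),\dots,c(\tau_k)],\tau)\cdot\operatorname{sign}([c(\tau_0),\dots,c(\tau_n)],\tau_n)$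 for any flag $\tau_0\prec\dots\prec\tau_k=\tau$ below $\tau$; $\lvert\ast\tau\rvert$ is the sum of the volumes of the simplices of $\ast\tau$. Let $\omega\in C^1\Lambda^k(\lvert K\rvert)$, i.e. $\omega$ is the restriction of a $C^1$ differential $k$-form on an open set containing $\lvert K\rvert$, and let $\lvert\omega\rvert_{C^1}=\sup_{x\in\lvert K\rvert}\lVert D\omega(x)\rVert$. With the de Rham maps $\langle R_h\omega,\tau\rangle=\int_\tau\omega$, $\langle R_h\star\omega,\ast\tau\rangle=\int_{\ast\tau}\star\omega$ and the discrete Hodge star $\langle\star_h\omega_h,\ast\tau\rangle=\frac{\lvert\ast\tau\rvert}{\lvert\tau\rvert}\langle\omega_h,\tau\rangle$, one has $$\bigl\lvert\langle\star_hR_h\omega,\ast\tau\rangle-\langle R_h\star\omega,\ast\tau\rangle\bigr\rvert\le C\,\lvert\omega\rvert_{C^1}\,\frac{h^{n+1}}{\gamma_\tau^{\,k}}.$$ That is, $\langle\star_hR_h\omega,\ast\tau\rangle=\langle R_h\star\omega,\ast\tau\rangle+O\bigl(h^{n+1}/\gamma_\tau^{\,k}\bigr)$. In particular this holds when $K$ consists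 of a single well-centered $n$-simplex $\sigma$ and its faces and $\omega\in C^1\Lambda^k(\sigma)$. -/

import Mathlib

open scoped EuclideanSpace

noncomputable section

namespace DEC

/-- Euclidean space `ℝⁿ`. -/
abbrev E (n : ℕ) : Type := EuclideanSpace ℝ (Fin n)

/-! ### Differential forms on subsets of `ℝⁿ` -/

/-- Differential `k`-forms on `ℝⁿ` (only the values near the relevant set matter). -/
abbrev Form (n k : ℕ) : Type := E n → E n [⋀^Fin k]→L[ℝ] ℝ

/-- `ω ∈ C^r Λ^k(Q)`: on `Q`, `ω` is the restriction of a form that is `C^r` on an open set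
containing `Q`. -/
def IsCr {n k : ℕ} (r : ℕ) (Q : Set (E n)) (ω : Form n k) : Prop :=
  ∃ O : Set (E n), IsOpen O ∧ Q ⊆ O ∧ ContDiffOn ℝ r ω O

/-- The first order seminorm `|ω|_{C^1(Q)} = sup_{x ∈ Q} ‖Dω(x)‖`. -/
def c1Seminorm {n k : ℕ} (Q : Set (E n)) (ω : Form n k) : ℝ :=
  sSup ((fun x => ‖fderiv ℝ ω x‖) '' Q)

/-- The alternating form `(u₁, …, u_m) ↦ vol(e₁, …, e_k, u₁, …, u_m)`. -/
def volContractLin {k m : ℕ} (o : Orientation ℝ (E (k + m)) (Fin (k + m)))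
    (e : Fin k → E (k + m)) : E (k + m) [⋀^Fin m]→ₗ[ℝ] ℝ where
  toFun u := o.volumeForm (Fin.append e u)
  map_update_add' := by
    intro inst u i x y
    have h : ∀ z, Fin.append e (Function.update u i z)
        = Function.update (Fin.append e u) (Fin.natAdd k i) z := by
      intro z
      ext1 j
      refine Fin.addCases (fun a => ?_) (fun a => ?_) j
      · rw [Fin.append_left, Function.update_of_ne, Fin.append_left]
        intro h
        have := congrArg Fin.val h
        simp only [Fin.val_castAdd, Fin.val_natAdd] at this
        omega
      · by_cases hai : a = i
        · subst hai; simp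
        · rw [Fin.append_right, Function.update_of_ne hai, Function.update_of_ne,
            Fin.append_right]
          simpa using hai
    rw [h, h, h, AlternatingMap.map_update_add]
  map_update_smul' := by
    intro inst u i c x
    have h : ∀ z, Fin.append e (Function.update u i z)
        = Function.update (Fin.append e u) (Fin.natAdd k i) z := by
      intro z
      ext1 j
      refine Fin.addCases (fun a => ?_) (fun a => ?_) j
      · rw [Fin.append_left, Function.update_of_ne, Fin.append_left]
        intro h
        have := congrArg Fin.val h
        simp only [Fin.val_castAdd, Fin.val_natAdd] at this
        omega
      · by_cases hai : a = i
        · subst hai; simp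
        · rw [Fin.append_right, Function.update_of_ne hai, Function.update_of_ne,
            Fin.append_right]
          simpa using hai
    rw [h, h, AlternatingMap.map_update_smul]
  map_eq_zero_of_eq' := by
    intro u i j hij hne
    refine AlternatingMap.map_eq_zero_of_eq (i := Fin.natAdd k i) (j := Fin.natAdd k j) _ _ ?_ ?_
    · rw [Fin.append_right, Fin.append_right, hij]
    · simpa using hne

/-- `volContractLin` as a continuous alternating form. -/
def volContract {k m : ℕ} (o : Orientation ℝ (E (k + m)) (Fin (k + m)))
    (e : Fin k → E (k + m)) : E (k + m) [⋀^Fin m]→L[ℝ] ℝ :=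
  (volContractLin o e).mkContinuous (∏ i, ‖e i‖) (by
    intro u
    refine (o.abs_volumeForm_apply_le (Fin.append e u)).trans (le_of_eq ?_)
    rw [Fin.prod_univ_add]
    simp)

/-- The Hodge star of a `k`-covector on oriented `ℝ^{k+m}`:
`⋆α = ∑_{i₁ < … < i_k} α(e_{i₁}, …, e_{i_k}) vol(e_{i₁}, …, e_{i_k}, ·)`, so that
`⋆(dλ₁ ∧ … ∧ dλ_k) = dλ_{k+1} ∧ … ∧ dλ_{k+m}` for positively oriented orthonormal coordinates. -/
def starCovector {k m : ℕ} (o : Orientation ℝ (E (k + m)) (Fin (k + m)))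
    (α : E (k + m) [⋀^Fin k]→L[ℝ] ℝ) : E (k + m) [⋀^Fin m]→L[ℝ] ℝ :=
  ∑ I : Fin k ↪o Fin (k + m),
    α (fun a => EuclideanSpace.basisFun (Fin (k + m)) ℝ (I a)) •
      volContract o (fun a => EuclideanSpace.basisFun (Fin (k + m)) ℝ (I a))

/-- The Hodge star `⋆ω` of a differential form, taken pointwise. -/
def star {k m : ℕ} (o : Orientation ℝ (E (k + m)) (Fin (k + m))) (ω : Form (k + m) k) :
    Form (k + m) m :=
  fun x => starCovector o (ω x)

/-! ### Affine simplices given by ordered vertices, and chains of them -/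

/-- The edge vectors `w₁ - w₀, …, w_j - w₀` of `[w₀, …, w_j]`. -/
def edges {n j : ℕ} (w : Fin (j + 1) → E n) : Fin j → E n := fun i => w i.succ - w 0

/-- The `j`-dimensional volume of `[w₀, …, w_j]` (Gram determinant formula); it is `1` for a
vertex. -/
def simplexVolume {n j : ℕ} (w : Fin (j + 1) → E n) : ℝ :=
  √(Matrix.det (Matrix.of fun a b : Fin j => inner ℝ (edges w a) (edges w b))) / (j.factorial : ℝ)

/-- The relative orientation `sign([w], [v])` of two `j`-simplices spanning the same plane: the
cross Gram determinant is the determinant of the change of basis from the edges of `v` to the edges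
of `w`, times the (positive) Gram determinant of the edges of `v`. -/
def relSign {n j : ℕ} (w v : Fin (j + 1) → E n) : ℤ :=
  (SignType.sign (Matrix.det (Matrix.of fun a b : Fin j => inner ℝ (edges w a) (edges v b))) : ℤ)

/-- The integral of a `j`-form over the oriented simplex `[w₀, …, w_j]`, through the affine
parametrization by the standard simplex. -/
def simplexIntegral {n j : ℕ} (η : Form n j) (w : Fin (j + 1) → E n) : ℝ :=
  ∫ t in {t : Fin j → ℝ | (∀ i, 0 ≤ t i) ∧ ∑ i, t i ≤ 1},
    η (w 0 + ∑ i, t i • edges w i) (edges w)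

/-- Chains of oriented affine `j`-simplices in `ℝⁿ`. -/
abbrev AffineChain (n j : ℕ) : Type := (Fin (j + 1) → E n) →₀ ℤ

/-- The integral of a `j`-form over a chain. -/
def chainIntegral {n j : ℕ} (η : Form n j) (c : AffineChain n j) : ℝ :=
  c.sum fun w a => (a : ℝ) * simplexIntegral η w

/-- The volume of a chain: the sum of the volumes of its simplices, with multiplicity. -/
def chainVolume {n j : ℕ} (c : AffineChain n j) : ℝ :=
  c.sum fun w a => |(a : ℝ)| * simplexVolume w

/-! ### Simplicial complexes -/

/-- The circumcenter of the simplex with vertex set `s`: the point of the plane of `s` that is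
equidistant from all the vertices. -/
def circumcenter {n : ℕ} (s : Finset (E n)) : E n :=
  Classical.epsilon fun c => c ∈ affineSpan ℝ (s : Set (E n)) ∧ ∃ r : ℝ, ∀ p ∈ s, dist p c = r

theorem circumcenter_eq {n j : ℕ} (T : Affine.Simplex ℝ (E n) j) (s : Finset (E n))
    (hs : (s : Set (E n)) = Set.range T.points) : circumcenter s = T.circumcenter := by
  have hex : ∃ c, c ∈ affineSpan ℝ (s : Set (E n)) ∧ ∃ r : ℝ, ∀ p ∈ s, dist p c = r := by
    refine ⟨T.circumcenter, hs ▸ T.circumcenter_mem_affineSpan, T.circumradius, fun p hp => ?_⟩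
    have hp' : p ∈ Set.range T.points := hs ▸ (Finset.mem_coe.2 hp)
    obtain ⟨i, rfl⟩ := hp'
    exact T.dist_circumcenter_eq_circumradius i
  obtain ⟨h1, r, h2⟩ := Classical.epsilon_spec hex
  refine T.eq_circumcenter_of_dist_eq (r := r) (hs ▸ h1) fun i => h2 _ ?_
  exact Finset.mem_coe.1 (hs ▸ Set.mem_range_self i)

/-- The radius of the largest ball, in the plane of the simplex with vertex set `s`, that is
contained in that simplex. -/
def inradius {n : ℕ} (s : Finset (E n)) : ℝ :=
  sSup {r : ℝ | 0 ≤ r ∧ ∃ x ∈ convexHull ℝ (s : Set (E n)),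
    Metric.closedBall x r ∩ (affineSpan ℝ (s : Set (E n)) : Set (E n))
      ⊆ convexHull ℝ (s : Set (E n))}

/-- The simplicial complex is well-centered: the circumcenter of each of its simplices lies in the
(relative) interior of that simplex. -/
def WellCentered {n : ℕ} (K : Geometry.SimplicialComplex ℝ (E n)) : Prop :=
  ∀ s ∈ K.faces, circumcenter s ∈ intrinsicInterior ℝ (convexHull ℝ (s : Set (E n)))

/-- The mesh size of a complex: the length of its longest edge. -/
def meshSize {n : ℕ} (K : Geometry.SimplicialComplex ℝ (E n)) : ℝ :=
  sSup {d : ℝ | ∃ s ∈ K.faces, ∃ p ∈ s, ∃ q ∈ s, d = dist p q}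

/-- The `k`-simplices `Δ_k(K)` of a complex. -/
def Simp {n : ℕ} (K : Geometry.SimplicialComplex ℝ (E n)) (k : ℕ) : Type :=
  {s : Finset (E n) // s ∈ K.faces ∧ s.card = k + 1}

/-- An orientation of every simplex of `K`, given by an ordering of its vertices. -/
structure SimplexOrientation {n : ℕ} (K : Geometry.SimplicialComplex ℝ (E n)) where
  vert : (k : ℕ) → Simp K k → Fin (k + 1) → E n
  range_vert : ∀ (k : ℕ) (τ : Simp K k), Set.range (vert k τ) = (τ.1 : Set (E n))

/-- All `n`-simplices are positively oriented with respect to the orientation `o` of `ℝⁿ`. -/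
def SimplexOrientation.TopPositive {n : ℕ} {K : Geometry.SimplicialComplex ℝ (E n)}
    (O : SimplexOrientation K) (o : Orientation ℝ (E n) (Fin n)) : Prop :=
  ∀ σ : Simp K n, 0 < o.volumeForm (edges (O.vert n σ))

/-! ### Circumcentric duality -/

section Dual

variable {k m : ℕ} {K : Geometry.SimplicialComplex ℝ (E (k + m))}

/-- A flag `v ≺ … ≺ τ ≺ … ≺ σ` of simplices of `K` of dimensions `0, …, k, …, k + m` through the
`k`-simplex `τ = [v₀, …, v_k]`. The part below `τ`, which only serves to compute signs, is
fixed to be `[v₀] ≺ [v₀, v₁] ≺ … ≺ [v₀, …, v_k]`; the part above `τ` is arbitrary. -/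
structure DualFlag (O : SimplexOrientation K) (τ : Simp K k) where
  simp : (i : Fin (k + m + 1)) → Simp K i
  mono : ∀ i j, i ≤ j → (simp i).1 ⊆ (simp j).1
  lower : ∀ i : Fin (k + 1),
    ((simp (Fin.castLE (by omega) i)).1 : Set (E (k + m))) = O.vert k τ '' Set.Iic i

namespace DualFlag

variable {O : SimplexOrientation K} {τ : Simp K k}

/-- The circumcenters of the simplices of the flag. -/
def centers (F : DualFlag O τ) : Fin (k + m + 1) → E (k + m) :=
  fun i => circumcenter (F.simp i).1

/-- The elementary dual simplex `[c(τ), …, c(σ)]`. -/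
def piece (F : DualFlag O τ) : Fin (m + 1) → E (k + m) :=
  fun i => F.centers (Fin.natAdd k i)

/-- The sign `sign([c(v), …, c(τ)], τ) · sign([c(v), …, c(σ)], σ)`. -/
def sgn (F : DualFlag O τ) : ℤ :=
  relSign (fun i : Fin (k + 1) => F.centers (Fin.castLE (by omega) i)) (O.vert k τ) *
    relSign F.centers (O.vert (k + m) (F.simp (Fin.last (k + m))))

end DualFlag

theorem finite_dualFlag (hK : K.faces.Finite) (O : SimplexOrientation K) (τ : Simp K k) :
    Finite (DualFlag O τ) := by
  have h : ∀ i : ℕ, Finite (Simp K i) := by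
    intro i
    have : Finite K.faces := hK.to_subtype
    refine Finite.of_injective (β := K.faces) (fun s => ⟨s.1, s.2.1⟩) ?_
    intro s t hst
    exact Subtype.ext (congrArg (fun x : K.faces => x.1) hst)
  refine Finite.of_injective (β := (i : Fin (k + m + 1)) → Simp K i) DualFlag.simp ?_
  rintro ⟨s, _, _⟩ ⟨t, _, _⟩ h
  cases h
  rfl

/-- The dual `∗τ = ∑ ± [c(τ), …, c(σ)]` of a `k`-simplex (a finite sum when `K` is finite). -/
def dualCell (O : SimplexOrientation K) (τ : Simp K k) : AffineChain (k + m) m :=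
  ∑ᶠ F : DualFlag O τ, Finsupp.single F.piece F.sgn

end Dual

/-! ### Cochains, de Rham maps and the discrete Hodge star -/

/-- The `k`-chains `C_k(K)`: the free abelian group on the (oriented) `k`-simplices. -/
abbrev Chain {n : ℕ} (K : Geometry.SimplicialComplex ℝ (E n)) (k : ℕ) : Type := Simp K k →₀ ℤ

/-- The `k`-cochains `C^k(K) = Hom(C_k(K), ℝ)`. -/
abbrev Cochain {n : ℕ} (K : Geometry.SimplicialComplex ℝ (E n)) (k : ℕ) : Type := Chain K k →+ ℝ

/-- The value `⟨ω_h, τ⟩` of a cochain on a simplex. -/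
def Cochain.eval {n : ℕ} {K : Geometry.SimplicialComplex ℝ (E n)} {k : ℕ} (α : Cochain K k)
    (τ : Simp K k) : ℝ := α (Finsupp.single τ 1)

/-- The cochain with prescribed values on simplices. -/
def Cochain.ofValues {n : ℕ} {K : Geometry.SimplicialComplex ℝ (E n)} {k : ℕ} (f : Simp K k → ℝ) :
    Cochain K k := Finsupp.liftAddHom fun τ => (zmultiplesHom ℝ) (f τ)

theorem Cochain.eval_ofValues {n : ℕ} {K : Geometry.SimplicialComplex ℝ (E n)} {k : ℕ}
    (f : Simp K k → ℝ) (τ : Simp K k) : (Cochain.ofValues f).eval τ = f τ := by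
  simp [Cochain.ofValues, Cochain.eval]

/-- The cochains on the dual mesh, `C^{n-k}(∗K) = Hom(C_{n-k}(∗K), ℝ)`. As `C_{n-k}(∗K)` is
the free abelian group on the cells `∗τ`, `τ ∈ Δ_k(K)`, it is identified with `C_k(K)` through
`τ ↦ ∗τ`. -/
structure DualCochain {n : ℕ} (K : Geometry.SimplicialComplex ℝ (E n)) (k : ℕ) where
  toHom : Chain K k →+ ℝ

/-- The value `⟨α, ∗τ⟩` of a dual cochain on the dual of a simplex. -/
def DualCochain.evalDual {n : ℕ} {K : Geometry.SimplicialComplex ℝ (E n)} {k : ℕ}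
    (α : DualCochain K k) (τ : Simp K k) : ℝ := α.toHom (Finsupp.single τ 1)

/-- The de Rham map on `K`: `⟨R_h ω, τ⟩ = ∫_τ ω`. -/
def deRham {n k : ℕ} {K : Geometry.SimplicialComplex ℝ (E n)} (O : SimplexOrientation K)
    (ω : Form n k) : Cochain K k :=
  Cochain.ofValues fun τ => simplexIntegral ω (O.vert k τ)

/-- The de Rham map on the dual mesh: `⟨R_h η, ∗τ⟩ = ∫_{∗τ} η`. -/
def deRhamDual {k m : ℕ} {K : Geometry.SimplicialComplex ℝ (E (k + m))}
    (O : SimplexOrientation K) (η : Form (k + m) m) : DualCochain K k :=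
  ⟨Cochain.ofValues fun τ => chainIntegral η (dualCell O τ)⟩

/-- The discrete Hodge star: `⟨⋆_h ω_h, ∗τ⟩ = (|∗τ| / |τ|) ⟨ω_h, τ⟩`. -/
def discreteStar {k m : ℕ} {K : Geometry.SimplicialComplex ℝ (E (k + m))}
    (O : SimplexOrientation K) (α : Cochain K k) : DualCochain K k :=
  ⟨Cochain.ofValues fun τ =>
    chainVolume (dualCell O τ) / simplexVolume (O.vert k τ) * α.eval τ⟩

end DEC

end

noncomputable section

namespace DEC

/-! ### Alternating forms in orthonormal coordinates -/

theorem alternatingMap_eq_det_mul {V ι : Type*} [AddCommGroup V] [Module ℝ V] [Fintype ι]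
    [DecidableEq ι] (f : V [⋀^ι]→ₗ[ℝ] ℝ) (u w : ι → V) (M : Matrix ι ι ℝ)
    (h : ∀ j, w j = ∑ i, M i j • u i) : f w = M.det * f u := by
  have key := (f.compLinearMap (Fintype.linearCombination ℝ u)).eq_smul_basis_det (Pi.basisFun ℝ ι)
  have h1 := congrArg (fun g => g fun j i => M i j) key
  simp only [AlternatingMap.compLinearMap_apply, AlternatingMap.smul_apply,
    Pi.basisFun_det_apply] at h1
  have h2 : (fun j => Fintype.linearCombination ℝ u fun i => M i j) = w := by
    funext j
    rw [h j, Fintype.linearCombination_apply]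
  have h3 : (fun j => Fintype.linearCombination ℝ u (Pi.basisFun ℝ ι j)) = u := by
    funext j
    simp [Fintype.linearCombination_apply, Pi.single_apply]
  have h4 : (Matrix.of fun j i => M i j).det = M.det := Matrix.det_transpose M
  rw [h2, h3] at h1
  rw [h1, h4, smul_eq_mul, mul_comm]

theorem det_inner_eq_mul {n : ℕ} {ι : Type*} [Fintype ι] [DecidableEq ι] {u : ι → E n}
    (hu : Orthonormal ℝ u) (w v : ι → E n) (M N : Matrix ι ι ℝ)
    (hw : ∀ j, w j = ∑ i, M i j • u i) (hv : ∀ j, v j = ∑ i, N i j • u i) :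
    Matrix.det (Matrix.of fun a b => inner ℝ (w a) (v b)) = M.det * N.det := by
  rw [← Matrix.det_transpose M, ← Matrix.det_mul]
  congr 1
  ext a b
  rw [Matrix.of_apply, hw, hv, hu.inner_sum]
  simp [Matrix.mul_apply]

theorem orthonormalBasis_sum_inner_smul {n : ℕ} {ι : Type*} [Fintype ι]
    (b : OrthonormalBasis ι ℝ (E n)) (x : E n) : x = ∑ i, inner ℝ (b i) x • b i :=
  (b.sum_repr' x).symm

theorem det_inner_eq_volumeForm_mul {n : ℕ} (o : Orientation ℝ (E n) (Fin n)) (x y : Fin n → E n) :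
    Matrix.det (Matrix.of fun a b => inner ℝ (x a) (y b)) = o.volumeForm x * o.volumeForm y := by
  let b := EuclideanSpace.basisFun (Fin n) ℝ
  have hx := alternatingMap_eq_det_mul o.volumeForm b x (Matrix.of fun i j => inner ℝ (b i) (x j))
    fun j => orthonormalBasis_sum_inner_smul b (x j)
  have hy := alternatingMap_eq_det_mul o.volumeForm b y (Matrix.of fun i j => inner ℝ (b i) (y j))
    fun j => orthonormalBasis_sum_inner_smul b (y j)
  have hb := o.abs_volumeForm_apply_of_orthonormal b
  have hb2 : o.volumeForm b * o.volumeForm b = 1 := by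
    rw [← abs_mul_abs_self, hb, one_mul]
  rw [det_inner_eq_mul b.orthonormal x y (Matrix.of fun i j => inner ℝ (b i) (x j))
    (Matrix.of fun i j => inner ℝ (b i) (y j))
    (fun j => orthonormalBasis_sum_inner_smul b (x j))
    (fun j => orthonormalBasis_sum_inner_smul b (y j)), hx, hy]
  linear_combination (-(Matrix.of fun i j => inner ℝ (b i) (x j)).det *
    (Matrix.of fun i j => inner ℝ (b i) (y j)).det) * hb2

section Split

variable {k m : ℕ} (b : OrthonormalBasis (Fin k ⊕ Fin m) ℝ (E (k + m)))
  (o : Orientation ℝ (E (k + m)) (Fin (k + m)))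

/-- The sign of the orthonormal basis `b` with respect to the orientation `o`. -/
def splitSign : ℝ :=
  o.volumeForm (Fin.append (fun i => b (Sum.inl i)) fun j => b (Sum.inr j))

theorem append_eq_reindex :
    Fin.append (fun i => b (Sum.inl i)) (fun j => b (Sum.inr j)) = b.reindex finSumFinEquiv := by
  ext1 j
  refine Fin.addCases (fun a => ?_) (fun a => ?_) j <;> simp

theorem abs_splitSign : |splitSign b o| = 1 := by
  rw [splitSign, append_eq_reindex, o.abs_volumeForm_apply_of_orthonormal]

/-- The matrix of inner products with the first `k` basis vectors. -/
def coordFst (x : Fin k → E (k + m)) : Matrix (Fin k) (Fin k) ℝ :=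
  Matrix.of fun i j => inner ℝ (b (Sum.inl i)) (x j)

/-- The matrix of inner products with the last `m` basis vectors. -/
def coordSnd (x : Fin m → E (k + m)) : Matrix (Fin m) (Fin m) ℝ :=
  Matrix.of fun i j => inner ℝ (b (Sum.inr i)) (x j)

theorem volumeForm_append (a : Fin k → E (k + m)) (e : Fin m → E (k + m)) :
    o.volumeForm (Fin.append a e) =
      (Matrix.fromBlocks (coordFst b a) (Matrix.of fun i j => inner ℝ (b (Sum.inl i)) (e j))
        (Matrix.of fun i j => inner ℝ (b (Sum.inr i)) (a j)) (coordSnd b e)).det *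
        splitSign b o := by
  rw [alternatingMap_eq_det_mul o.volumeForm (b.reindex finSumFinEquiv) (Fin.append a e)
    (Matrix.of fun i j => inner ℝ (b.reindex finSumFinEquiv i) (Fin.append a e j))
    (fun j => orthonormalBasis_sum_inner_smul _ _), splitSign, append_eq_reindex,
    ← Matrix.det_submatrix_equiv_self finSumFinEquiv]
  congr 2
  ext i j
  rcases i with i | i <;> rcases j with j | j <;> simp [coordFst, coordSnd]

theorem volumeForm_append_of_fst_orthogonal (a : Fin k → E (k + m)) (e : Fin m → E (k + m))
    (h : ∀ i j, inner ℝ (b (Sum.inr i)) (a j) = (0 : ℝ)) :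
    o.volumeForm (Fin.append a e) =
      (coordFst b a).det * (coordSnd b e).det * splitSign b o := by
  rw [volumeForm_append b o]
  have : (Matrix.of fun i j => inner ℝ (b (Sum.inr i)) (a j)) = 0 := by ext i j; simp [h]
  rw [this, Matrix.det_fromBlocks_zero₂₁]

theorem volumeForm_append_of_snd_orthogonal (a : Fin k → E (k + m)) (e : Fin m → E (k + m))
    (h : ∀ i j, inner ℝ (b (Sum.inl i)) (e j) = (0 : ℝ)) :
    o.volumeForm (Fin.append a e) =
      (coordFst b a).det * (coordSnd b e).det * splitSign b o := by
  rw [volumeForm_append b o]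
  have : (Matrix.of fun i j => inner ℝ (b (Sum.inl i)) (e j)) = 0 := by ext i j; simp [h]
  rw [this, Matrix.det_fromBlocks_zero₁₂]

theorem eq_sum_fst (x : E (k + m)) (h : ∀ i, inner ℝ (b (Sum.inr i)) x = (0 : ℝ)) :
    x = ∑ i, inner ℝ (b (Sum.inl i)) x • b (Sum.inl i) := by
  conv_lhs => rw [orthonormalBasis_sum_inner_smul b x]
  simp [h]

theorem eq_sum_snd (x : E (k + m)) (h : ∀ i, inner ℝ (b (Sum.inl i)) x = (0 : ℝ)) :
    x = ∑ i, inner ℝ (b (Sum.inr i)) x • b (Sum.inr i) := by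
  conv_lhs => rw [orthonormalBasis_sum_inner_smul b x]
  simp [h]

theorem alternatingMap_eq_sum_orderEmb {n k : ℕ} (α : E n [⋀^Fin k]→ₗ[ℝ] ℝ) (t : Fin k → E n) :
    α t = ∑ I : Fin k ↪o Fin n,
      (Matrix.of fun i j => inner ℝ (t i) (EuclideanSpace.basisFun (Fin n) ℝ (I j))).det *
        α fun a => EuclideanSpace.basisFun (Fin n) ℝ (I a) := by
  let e := (EuclideanSpace.basisFun (Fin n) ℝ).toBasis
  have h1 : α t = exteriorPower.alternatingMapLinearEquiv α (exteriorPower.ιMulti ℝ k t) := by simp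
  rw [h1, ← (e.exteriorPower k).sum_repr (exteriorPower.ιMulti ℝ k t), map_sum,
    ← Set.powersetCard.ofFinEmbEquiv.sum_comp]
  refine Finset.sum_congr rfl fun I _ => ?_
  rw [map_smul, exteriorPower.basis_repr_apply, exteriorPower.ιMultiDual_apply_ιMulti,
    exteriorPower.basis_apply, exteriorPower.ιMulti_family,
    exteriorPower.alternatingMapLinearEquiv_apply_ιMulti, smul_eq_mul]
  congr 2
  · ext i j
    simp [e, EuclideanSpace.inner_single_right]
  · funext a
    simp [e]

theorem starCovector_apply_snd (α : E (k + m) [⋀^Fin k]→L[ℝ] ℝ) :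
    starCovector o α (fun j => b (Sum.inr j)) =
      splitSign b o * α fun i => b (Sum.inl i) := by
  have h := alternatingMap_eq_sum_orderEmb α.toAlternatingMap fun i => b (Sum.inl i)
  have h2 : ∀ I : Fin k ↪o Fin (k + m),
      volContract o (fun a => EuclideanSpace.basisFun (Fin (k + m)) ℝ (I a))
        (fun j => b (Sum.inr j)) =
      (Matrix.of fun i j => inner ℝ (b (Sum.inl i))
        (EuclideanSpace.basisFun (Fin (k + m)) ℝ (I j))).det * splitSign b o := by
    intro I
    change o.volumeForm (Fin.append _ _) = _
    rw [volumeForm_append_of_snd_orthogonal b o _ _ fun i j => b.inner_eq_zero (by simp)]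
    have : coordSnd b (fun j => b (Sum.inr j)) = 1 := by
      ext i j
      simp [coordSnd, b.inner_eq_ite, Matrix.one_apply]
    rw [this, Matrix.det_one, mul_one]
    rfl
  simp only [ContinuousAlternatingMap.coe_toAlternatingMap] at h
  rw [h, Finset.mul_sum, starCovector, ContinuousAlternatingMap.sum_apply]
  refine Finset.sum_congr rfl fun I _ => ?_
  rw [ContinuousAlternatingMap.smul_apply, h2, smul_eq_mul]
  ring

end Split

theorem exists_split_orthonormalBasis {k m : ℕ} (g : Fin k → E (k + m))
    (hg : LinearIndependent ℝ g) :
    ∃ b : OrthonormalBasis (Fin k ⊕ Fin m) ℝ (E (k + m)),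
      (∀ x ∈ Submodule.span ℝ (Set.range g), ∀ j, inner ℝ (b (Sum.inr j)) x = (0 : ℝ)) ∧
      ∀ x, (∀ i, inner ℝ (g i) x = (0 : ℝ)) → ∀ i, inner ℝ (b (Sum.inl i)) x = (0 : ℝ) := by
  set P := Submodule.span ℝ (Set.range g) with hP
  have hd : Module.finrank ℝ P = k := by
    rw [finrank_span_eq_card hg, Fintype.card_fin]
  let t : OrthonormalBasis (Fin k) ℝ P := (stdOrthonormalBasis ℝ P).reindex (finCongr hd)
  let v : Fin k ⊕ Fin m → E (k + m) := Sum.elim (fun i => (t i : E (k + m))) fun _ => 0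
  have hv : Orthonormal ℝ ((Set.range (Sum.inl : Fin k → Fin k ⊕ Fin m)).domRestrict v) := by
    have h0 : Orthonormal ℝ (fun i => (t i : E (k + m))) :=
      t.orthonormal.comp_linearIsometry P.subtypeₗᵢ
    rw [orthonormal_iff_ite] at h0 ⊢
    rintro ⟨_, i, rfl⟩ ⟨_, j, rfl⟩
    simpa [v, Set.domRestrict, Subtype.ext_iff] using h0 i j
  obtain ⟨b, hb⟩ := hv.exists_orthonormalBasis_extension_of_card_eq (by simp)
  have hbt : ∀ i, b (Sum.inl i) = t i := fun i => by rw [hb _ ⟨i, rfl⟩]; rfl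
  refine ⟨b, fun x hx j => ?_, fun x hx i => ?_⟩
  · have h := congrArg Subtype.val (t.sum_repr' ⟨x, hx⟩)
    simp only [Submodule.coe_sum, Submodule.coe_smul] at h
    rw [← h, inner_sum]
    refine Finset.sum_eq_zero fun i _ => ?_
    rw [inner_smul_right, ← hbt, b.inner_eq_zero (by simp), mul_zero]
  · have hx' : x ∈ Pᗮ := by
      rw [hP, Submodule.mem_orthogonal]
      intro u hu
      induction hu using Submodule.span_induction with
      | mem u hu => obtain ⟨i, rfl⟩ := hu; exact hx i
      | zero => simp
      | add u w _ _ hu hw => rw [inner_add_left, hu, hw, add_zero]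
      | smul c u _ hu => rw [inner_smul_left, hu, mul_zero]
    rw [hbt]
    exact (Submodule.mem_orthogonal P x).1 hx' _ (t i).2

/-! ### The standard simplex -/

section StandardSimplex

open MeasureTheory

/-- The scaled corner simplex `{t | 0 ≤ tᵢ, ∑ tᵢ ≤ r}`. -/
def cornerSimplex (j : ℕ) (r : ℝ) : Set (Fin j → ℝ) := {t | (∀ i, 0 ≤ t i) ∧ ∑ i, t i ≤ r}

/-- The open corner simplex `{t | 0 < tᵢ, ∑ tᵢ < 1}`. -/
def openCornerSimplex (j : ℕ) : Set (Fin j → ℝ) := {t | (∀ i, 0 < t i) ∧ ∑ i, t i < 1}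

theorem isClosed_cornerSimplex (j : ℕ) (r : ℝ) : IsClosed (cornerSimplex j r) := by
  have h : IsClosed {t : Fin j → ℝ | ∑ i, t i ≤ r} := isClosed_le (by fun_prop) continuous_const
  refine IsClosed.inter (s₁ := {t : Fin j → ℝ | ∀ i, 0 ≤ t i}) ?_ h
  simp only [Set.ofPred_forall]
  exact isClosed_iInter fun i => isClosed_le continuous_const (continuous_apply i)

theorem isOpen_openCornerSimplex (j : ℕ) : IsOpen (openCornerSimplex j) := by
  have h : IsOpen {t : Fin j → ℝ | ∑ i, t i < 1} := isOpen_lt (by fun_prop) continuous_const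
  refine IsOpen.inter (s := {t : Fin j → ℝ | ∀ i, 0 < t i}) ?_ h
  simp only [Set.ofPred_forall]
  exact isOpen_iInter_of_finite fun i => isOpen_lt continuous_const (continuous_apply i)

theorem openCornerSimplex_nonempty (j : ℕ) : (openCornerSimplex j).Nonempty := by
  refine ⟨fun _ => 1 / (j + 1), fun i => by positivity, ?_⟩
  have h : (0 : ℝ) < j + 1 := by positivity
  simp only [Finset.sum_const, Finset.card_univ, Fintype.card_fin, nsmul_eq_mul]
  rw [mul_one_div, div_lt_one h]
  linarith

theorem isCompact_cornerSimplex (j : ℕ) : IsCompact (cornerSimplex j 1) := by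
  refine (isCompact_univ_pi fun _ : Fin j => isCompact_Icc (a := (0 : ℝ)) (b := 1)).of_isClosed_subset
    (isClosed_cornerSimplex j 1) fun t ht i _ => ⟨ht.1 i, ?_⟩
  exact (Finset.single_le_sum (fun a _ => ht.1 a) (Finset.mem_univ i)).trans ht.2

theorem volume_cornerSimplex (j : ℕ) : ∀ r : ℝ, 0 ≤ r →
    volume (cornerSimplex j r) = ENNReal.ofReal (r ^ j / j.factorial) := by
  induction j with
  | zero =>
    intro r hr
    have : cornerSimplex 0 r = Set.univ := by ext t; simp [cornerSimplex, hr]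
    rw [this]
    simp [volume_pi]
  | succ j ih =>
    intro r hr
    have hmp := volume_preserving_piFinSuccAbove (fun _ : Fin (j + 1) => ℝ) 0
    have hpre : cornerSimplex (j + 1) r = MeasurableEquiv.piFinSuccAbove (fun _ => ℝ) 0 ⁻¹'
        {p : ℝ × (Fin j → ℝ) | 0 ≤ p.1 ∧ p.2 ∈ cornerSimplex j (r - p.1)} := by
      ext t
      simp only [cornerSimplex, Set.mem_ofPred_eq, Set.mem_preimage,
        MeasurableEquiv.piFinSuccAbove_apply, Fin.forall_fin_succ, Fin.sum_univ_succ,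
        Fin.insertNthEquiv_symm_apply]
      simp only [Fin.removeNth, Fin.zero_succAbove]
      constructor
      · rintro ⟨⟨h1, h2⟩, h3⟩
        exact ⟨h1, h2, by linarith⟩
      · rintro ⟨h1, h2, h3⟩
        exact ⟨⟨h1, h2⟩, by linarith⟩
    have hmeas : MeasurableSet
        {p : ℝ × (Fin j → ℝ) | 0 ≤ p.1 ∧ p.2 ∈ cornerSimplex j (r - p.1)} := by
      refine IsClosed.measurableSet ?_
      refine IsClosed.inter (s₁ := {p : ℝ × (Fin j → ℝ) | 0 ≤ p.1})
        (isClosed_le continuous_const continuous_fst) ?_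
      have h : IsClosed {p : ℝ × (Fin j → ℝ) | ∑ i, p.2 i ≤ r - p.1} :=
        isClosed_le (by fun_prop) (by fun_prop)
      refine IsClosed.inter (s₁ := {p : ℝ × (Fin j → ℝ) | ∀ i, 0 ≤ p.2 i}) ?_ h
      simp only [Set.ofPred_forall]
      exact isClosed_iInter fun i => isClosed_le continuous_const (by fun_prop)
    rw [hpre, hmp.measure_preimage hmeas.nullMeasurableSet, Measure.volume_eq_prod,
      Measure.prod_apply hmeas]
    have hfib : ∀ x : ℝ, volume (Prod.mk x ⁻¹'
        {p : ℝ × (Fin j → ℝ) | 0 ≤ p.1 ∧ p.2 ∈ cornerSimplex j (r - p.1)}) =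
        (Set.Icc 0 r).indicator (fun x => ENNReal.ofReal ((r - x) ^ j / j.factorial)) x := by
      intro x
      by_cases hx : x ∈ Set.Icc 0 r
      · rw [Set.indicator_of_mem hx, ← ih _ (by linarith [hx.2])]
        congr 1
        ext y
        simp [hx.1]
      · rw [Set.indicator_of_notMem hx]
        convert! measure_empty (μ := volume (α := Fin j → ℝ))
        ext y
        simp only [Set.mem_preimage, Set.mem_ofPred_eq, Set.mem_empty_iff_false, iff_false]
        rintro ⟨h1, h2, h3⟩
        exact hx ⟨h1, by linarith [Finset.sum_nonneg fun i (_ : i ∈ Finset.univ) => h2 i]⟩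
    simp_rw [hfib]
    rw [lintegral_indicator measurableSet_Icc, ← ofReal_integral_eq_lintegral_ofReal]
    · rw [integral_Icc_eq_integral_Ioc, ← intervalIntegral.integral_of_le hr,
        intervalIntegral.integral_div, intervalIntegral.integral_comp_sub_left (fun x => x ^ j),
        integral_pow]
      congr 1
      rw [Nat.factorial_succ]
      push_cast
      simp
      field_simp
    · exact (Continuous.integrableOn_Icc (by fun_prop))
    · filter_upwards [ae_restrict_mem measurableSet_Icc] with x hx
      have : 0 ≤ r - x := by linarith [hx.2]
      simp only [Pi.zero_apply]
      positivity

theorem volumeReal_cornerSimplex (j : ℕ) :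
    volume.real (cornerSimplex j 1) = 1 / (j.factorial : ℝ) := by
  rw [Measure.real, volume_cornerSimplex j 1 zero_le_one, one_pow,
    ENNReal.toReal_ofReal (by positivity)]

/-- A function close to a constant `a` has an integral over the standard simplex close to `a / j!`. -/
theorem abs_factorial_mul_integral_sub_le {j : ℕ} {f : (Fin j → ℝ) → ℝ} {a D : ℝ}
    (hf : ContinuousOn f (cornerSimplex j 1)) (h : ∀ t ∈ cornerSimplex j 1, |f t - a| ≤ D) :
    |(j.factorial : ℝ) * (∫ t in cornerSimplex j 1, f t) - a| ≤ D := by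
  have hfin : volume (cornerSimplex j 1) < ⊤ := (isCompact_cornerSimplex j).measure_lt_top
  have h1 : ∫ t in cornerSimplex j 1, (f t - a) =
      (∫ t in cornerSimplex j 1, f t) - 1 / (j.factorial : ℝ) * a := by
    rw [integral_sub (hf.integrableOn_compact (isCompact_cornerSimplex j))
      (integrableOn_const hfin.ne), setIntegral_const, volumeReal_cornerSimplex, smul_eq_mul]
  have h2 := norm_setIntegral_le_of_norm_le_const (f := fun t => f t - a) hfin h
  rw [h1, volumeReal_cornerSimplex, Real.norm_eq_abs] at h2
  have hp : (0 : ℝ) < j.factorial := by positivity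
  have h3 : (j.factorial : ℝ) * (∫ t in cornerSimplex j 1, f t) - a =
      j.factorial * ((∫ t in cornerSimplex j 1, f t) - 1 / (j.factorial : ℝ) * a) := by
    field_simp
  rw [h3, abs_mul, abs_of_pos hp]
  calc _ ≤ (j.factorial : ℝ) * (D * (1 / j.factorial)) := by gcongr
    _ = D := by field_simp

end StandardSimplex

/-! ### Circumcenters and mesh size -/

section Complex

variable {n : ℕ} {K : Geometry.SimplicialComplex ℝ (E n)}

theorem circumcenter_spec {s : Finset (E n)} (hs : s ∈ K.faces) :
    circumcenter s ∈ affineSpan ℝ (s : Set (E n)) ∧ ∃ r : ℝ, ∀ p ∈ s, dist p (circumcenter s) = r := by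
  obtain ⟨j, hj⟩ : ∃ j, s.card = j + 1 :=
    Nat.exists_eq_succ_of_ne_zero (Finset.card_ne_zero.2 (K.nonempty_of_mem_faces hs))
  let e : Fin (j + 1) ≃ s := (s.equivFinOfCardEq hj).symm
  let T : Affine.Simplex ℝ (E n) j :=
    ⟨fun i => (e i : E n), (K.indep hs).comp_embedding e.toEmbedding⟩
  have hT : (s : Set (E n)) = Set.range T.points := by
    ext p
    constructor
    · intro hp
      exact ⟨e.symm ⟨p, hp⟩, by simp [T]⟩
    · rintro ⟨i, rfl⟩
      exact (e i).2
  rw [circumcenter_eq T s hT]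
  refine ⟨hT ▸ T.circumcenter_mem_affineSpan, T.circumradius, fun p hp => ?_⟩
  obtain ⟨i, rfl⟩ : p ∈ Set.range T.points := hT ▸ Finset.mem_coe.2 hp
  exact T.dist_circumcenter_eq_circumradius i

theorem inner_sub_circumcenter_eq_zero {s t : Finset (E n)} (hs : s ∈ K.faces) (ht : t ∈ K.faces)
    (hst : s ⊆ t) {p q : E n} (hp : p ∈ s) (hq : q ∈ s) :
    inner ℝ (p - q) (circumcenter t - circumcenter s) = (0 : ℝ) := by
  obtain ⟨-, r, hr⟩ := circumcenter_spec hs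
  obtain ⟨-, r', hr'⟩ := circumcenter_spec ht
  have key : ∀ c : E n, dist p c = dist q c →
      2 * inner ℝ (p - q) c = inner ℝ p p - (inner ℝ q q : ℝ) := by
    intro c hc
    rw [dist_eq_norm, dist_eq_norm] at hc
    have h2 := congrArg (fun x => x ^ 2) hc
    simp only [← real_inner_self_eq_norm_sq, inner_sub_left, inner_sub_right] at h2
    rw [inner_sub_left]
    linarith [real_inner_comm p c, real_inner_comm q c]
  have h1 := key _ ((hr p hp).trans (hr q hq).symm)
  have h2 := key _ ((hr' p (hst hp)).trans (hr' q (hst hq)).symm)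
  rw [inner_sub_right]
  linarith

theorem circumcenter_mem_convexHull (hW : WellCentered K) {s t : Finset (E n)} (hs : s ∈ K.faces)
    (hst : s ⊆ t) : circumcenter s ∈ convexHull ℝ (t : Set (E n)) :=
  convexHull_mono (Finset.coe_subset.2 hst) (intrinsicInterior_subset (hW s hs))

theorem bddAbove_edgeLengths (hK : K.faces.Finite) :
    BddAbove {d : ℝ | ∃ s ∈ K.faces, ∃ p ∈ s, ∃ q ∈ s, d = dist p q} := by
  refine Set.Finite.bddAbove ?_
  refine (hK.biUnion fun s _ => ((s ×ˢ s).finite_toSet.image fun x => dist x.1 x.2)).subset ?_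
  rintro d ⟨s, hs, p, hp, q, hq, rfl⟩
  simp only [Set.mem_iUnion]
  exact ⟨s, hs, (p, q), by simp [hp, hq], rfl⟩

theorem dist_le_meshSize (hK : K.faces.Finite) {s : Finset (E n)} (hs : s ∈ K.faces) {x y : E n}
    (hx : x ∈ convexHull ℝ (s : Set (E n))) (hy : y ∈ convexHull ℝ (s : Set (E n))) :
    dist x y ≤ meshSize K := by
  obtain ⟨p, hp, q, hq, h⟩ := convexHull_exists_dist_ge2 hx hy
  exact h.trans (le_csSup (bddAbove_edgeLengths hK) ⟨s, hs, p, hp, q, hq, rfl⟩)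

theorem exists_ball_subset_of_mem_intrinsicInterior {A : Set (E n)} {c : E n}
    (h : c ∈ intrinsicInterior ℝ A) :
    ∃ r > 0, Metric.closedBall c r ∩ (affineSpan ℝ A : Set (E n)) ⊆ A := by
  obtain ⟨y, hy, rfl⟩ := mem_intrinsicInterior.1 h
  obtain ⟨r, hr, hb⟩ := Metric.nhds_basis_closedBall.mem_iff.1 (mem_interior_iff_mem_nhds.1 hy)
  refine ⟨r, hr, ?_⟩
  rintro x ⟨hx, hxA⟩
  exact hb (a := ⟨x, hxA⟩) hx

theorem inradius_bounds (hK : K.faces.Finite) (hW : WellCentered K) {s : Finset (E n)}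
    (hs : s ∈ K.faces) {p q : E n} (hp : p ∈ s) (hq : q ∈ s) (hpq : p ≠ q) :
    0 < inradius s ∧ inradius s ≤ meshSize K := by
  obtain ⟨r, hr, hb⟩ := exists_ball_subset_of_mem_intrinsicInterior (hW s hs)
  rw [affineSpan_convexHull] at hb
  have hbound : ∀ r' ∈ {r : ℝ | 0 ≤ r ∧ ∃ x ∈ convexHull ℝ (s : Set (E n)),
      Metric.closedBall x r ∩ (affineSpan ℝ (s : Set (E n)) : Set (E n))
        ⊆ convexHull ℝ (s : Set (E n))}, r' ≤ meshSize K := by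
    rintro r' ⟨hr', x, hx, hxb⟩
    have hd : 0 < ‖p - q‖ := norm_pos_iff.2 (sub_ne_zero.2 hpq)
    let y : E n := (r' / ‖p - q‖) • (p - q) + x
    have hdist : dist y x = r' := by
      simp [y, dist_eq_norm, norm_smul, abs_of_nonneg hr', hd.ne']
    have hy : y ∈ affineSpan ℝ (s : Set (E n)) := by
      refine AffineSubspace.vadd_mem_of_mem_direction (Submodule.smul_mem _ _ ?_)
        (convexHull_subset_affineSpan _ hx)
      exact AffineSubspace.vsub_mem_direction (mem_affineSpan ℝ (Finset.mem_coe.2 hp))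
        (mem_affineSpan ℝ (Finset.mem_coe.2 hq))
    rw [← hdist]
    exact dist_le_meshSize hK hs (hxb ⟨by simp [hdist], hy⟩) hx
  have hmem : r ∈ {r : ℝ | 0 ≤ r ∧ ∃ x ∈ convexHull ℝ (s : Set (E n)),
      Metric.closedBall x r ∩ (affineSpan ℝ (s : Set (E n)) : Set (E n))
        ⊆ convexHull ℝ (s : Set (E n))} :=
    ⟨hr.le, circumcenter s, circumcenter_mem_convexHull hW hs subset_rfl, hb⟩
  exact ⟨hr.trans_le (le_csSup ⟨_, hbound⟩ hmem), csSup_le ⟨_, hmem⟩ hbound⟩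

/-! ### Positive barycentric weights -/

/-- `w` is positive on `s` and vanishes elsewhere. -/
def PosOn {α : Type*} (w : α → ℝ) (s : Finset α) : Prop :=
  (∀ p ∈ s, 0 < w p) ∧ ∀ p ∉ s, w p = 0

namespace PosOn

variable {α : Type*} {w v : α → ℝ} {s t : Finset α}

theorem nonneg (h : PosOn w s) (p : α) : 0 ≤ w p := by
  by_cases hp : p ∈ s
  · exact (h.1 p hp).le
  · exact (h.2 p hp).ge

theorem subset_of_eq (h : PosOn w s) (h' : PosOn w t) : s ⊆ t := fun p hp => by
  by_contra hpt
  exact (h.1 p hp).ne' (h'.2 p hpt)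

theorem eq_of_eq (h : PosOn w s) (h' : PosOn w t) : s = t :=
  (h.subset_of_eq h').antisymm (h'.subset_of_eq h)

theorem smul {c : ℝ} (hc : 0 < c) (h : PosOn w s) : PosOn (c • w) s :=
  ⟨fun p hp => mul_pos hc (h.1 p hp), fun p hp => by simp [h.2 p hp]⟩

theorem add (h : PosOn w s) (hst : s ⊆ t) (h' : PosOn v t) : PosOn (w + v) t :=
  ⟨fun p hp => add_pos_of_nonneg_of_pos (h.nonneg p) (h'.1 p hp),
    fun p hp => by simp [h'.2 p hp, h.2 p (fun hs => hp (hst hs))]⟩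

end PosOn

theorem posOn_sum_chain {α : Type*} {m : ℕ} (A : Fin (m + 1) → Finset α)
    (w : Fin (m + 1) → α → ℝ) (hw : ∀ j, PosOn (w j) (A j)) (hA : Monotone A) (β : Fin (m + 1) → ℝ)
    (hβ : ∀ j, 0 < β j) : PosOn (∑ j, β j • w j) (A (Fin.last m)) := by
  induction m with
  | zero => simpa using (hw 0).smul (hβ 0)
  | succ m ih =>
    rw [Fin.sum_univ_castSucc]
    exact (ih (fun j => A j.castSucc) (fun j => w j.castSucc) (fun j => hw _)
      (fun i j hij => hA (Fin.castSucc_le_castSucc_iff.2 hij)) (fun j => β j.castSucc)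
      fun j => hβ _).add (hA (Fin.le_last _)) ((hw _).smul (hβ _))

/-- A positive combination of weights supported on a chain of finsets of increasing cardinality
determines the chain. -/
theorem chain_eq_of_sum_eq {α : Type*} {m : ℕ} (W : Finset α → α → ℝ) (c : ℕ)
    (A A' : Fin (m + 1) → Finset α)
    (hw : ∀ j, PosOn (W (A j)) (A j)) (hw' : ∀ j, PosOn (W (A' j)) (A' j))
    (hA : Monotone A) (hA' : Monotone A') (hc : ∀ j, (A j).card = c + j)
    (hc' : ∀ j, (A' j).card = c + j) (β β' : Fin (m + 1) → ℝ) (hβ : ∀ j, 0 < β j)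
    (hβ' : ∀ j, 0 < β' j) (h : ∑ j, β j • W (A j) = ∑ j, β' j • W (A' j)) : A = A' := by
  have hlast : A (Fin.last m) = A' (Fin.last m) := by
    refine PosOn.eq_of_eq (posOn_sum_chain A _ hw hA β hβ) ?_
    rw [h]
    exact posOn_sum_chain A' _ hw' hA' β' hβ'
  induction m with
  | zero =>
    funext j
    rw [Fin.fin_one_eq_zero j]
    exact hlast
  | succ m ih =>
    have hm : ∀ {B : Fin (m + 1 + 1) → Finset α}, Monotone B → Monotone fun j => B (Fin.castSucc j) :=
      fun hB i j hij => hB (Fin.castSucc_le_castSucc_iff.2 hij)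
    have hne : ∀ {B B' : Fin (m + 1 + 1) → Finset α} (γ γ' : Fin (m + 1 + 1) → ℝ),
        (∀ j, PosOn (W (B j)) (B j)) → (∀ j, PosOn (W (B' j)) (B' j)) → Monotone B → Monotone B' →
        (∀ j, (B j).card = c + j) → (∀ j, 0 < γ j) → (∀ j, 0 < γ' j) →
        ∑ j, γ j • W (B j) = ∑ j, γ' j • W (B' j) → B (Fin.last _) = B' (Fin.last _) →
        ¬ γ (Fin.last _) < γ' (Fin.last _) := by
      intro B B' γ γ' hB hB' hBm hBm' hcard hγ hγ' heq hl hlt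
      rw [Fin.sum_univ_castSucc, Fin.sum_univ_castSucc fun j => γ' j • W (B' j), ← hl] at heq
      have h1 := posOn_sum_chain (fun j => B (Fin.castSucc j)) _ (fun j => hB _) (hm hBm)
        (fun j => γ (Fin.castSucc j)) fun j => hγ _
      have h2 := (posOn_sum_chain (fun j => B' (Fin.castSucc j)) _ (fun j => hB' _) (hm hBm')
        (fun j => γ' (Fin.castSucc j)) fun j => hγ' _).add
        (hBm' (Fin.le_last _)) ((hB' (Fin.last _)).smul (sub_pos.2 hlt))
      have h3 : ∑ j : Fin (m + 1), γ (Fin.castSucc j) • W (B (Fin.castSucc j)) =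
          ∑ j : Fin (m + 1), γ' (Fin.castSucc j) • W (B' (Fin.castSucc j)) +
            (γ' (Fin.last _) - γ (Fin.last _)) • W (B' (Fin.last _)) := by
        rw [← hl, sub_smul, ← add_sub_assoc, ← heq, add_sub_cancel_right]
      rw [← h3] at h2
      have h4 := congrArg Finset.card ((h1.eq_of_eq h2).trans hl.symm)
      rw [hcard, hcard] at h4
      simp at h4
    have hβl : β (Fin.last _) = β' (Fin.last _) :=
      le_antisymm (not_lt.1 (hne β' β hw' hw hA' hA hc' hβ' hβ h.symm hlast.symm))
        (not_lt.1 (hne β β' hw hw' hA hA' hc hβ hβ' h hlast))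
    rw [Fin.sum_univ_castSucc, Fin.sum_univ_castSucc fun j => β' j • W (A' j), ← hlast, hβl] at h
    have h5 := add_right_cancel h
    have h6 := ih (fun j => A j.castSucc) (fun j => A' j.castSucc) (fun j => hw _) (fun j => hw' _)
      (hm hA) (hm hA') (fun j => hc _) (fun j => hc' _) _ _ (fun j => hβ _) (fun j => hβ' _) h5
      (by
        refine PosOn.eq_of_eq (posOn_sum_chain (fun j => A (Fin.castSucc j)) _ (fun j => hw _)
          (hm hA) (fun j => β (Fin.castSucc j)) fun j => hβ _) ?_
        rw [h5]
        exact posOn_sum_chain (fun j => A' (Fin.castSucc j)) _ (fun j => hw' _) (hm hA')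
          (fun j => β' (Fin.castSucc j)) fun j => hβ' _)
    funext j
    refine Fin.lastCases hlast (fun i => ?_) j
    exact congrFun h6 i

theorem weights_eq {s : Finset (E n)} (hs : s ∈ K.faces) {w v : E n → ℝ}
    (h1 : ∑ p ∈ s, w p = ∑ p ∈ s, v p) (h2 : ∑ p ∈ s, w p • p = ∑ p ∈ s, v p • p) :
    ∀ p ∈ s, w p = v p := by
  intro p hp
  have h := affineIndependent_iff.1 (K.indep hs) Finset.univ (fun q => w q - v q)
    (by rw [Finset.sum_coe_sort s fun q => w q - v q, Finset.sum_sub_distrib, h1, sub_self])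
    (by
      rw [Finset.sum_coe_sort s fun q => (w q - v q) • q]
      simp only [sub_smul]
      rw [Finset.sum_sub_distrib, h2, sub_self])
  exact sub_eq_zero.1 (h ⟨p, hp⟩ (Finset.mem_univ _))

theorem exists_posOn_circumcenter (hW : WellCentered K) {s : Finset (E n)} (hs : s ∈ K.faces) :
    ∃ w : E n → ℝ, PosOn w s ∧ ∑ p ∈ s, w p = 1 ∧ ∑ p ∈ s, w p • p = circumcenter s := by
  classical
  obtain ⟨w, hw0, hw1, hwc⟩ := Finset.mem_convexHull'.1
    (circumcenter_mem_convexHull hW hs subset_rfl)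
  obtain ⟨r, hr, hb⟩ := exists_ball_subset_of_mem_intrinsicInterior (hW s hs)
  rw [affineSpan_convexHull] at hb
  have hpos : ∀ p ∈ s, 0 < w p := by
    intro p hp
    set c := circumcenter s
    set ε := r / (1 + ‖c - p‖) with hε
    have hd : 0 < 1 + ‖c - p‖ := by positivity
    have hε0 : 0 < ε := by positivity
    have hmem : ε • (c - p) + c ∈ convexHull ℝ (s : Set (E n)) := by
      refine hb ⟨?_, ?_⟩
      · rw [Metric.mem_closedBall, dist_eq_norm, add_sub_cancel_right, norm_smul,
          Real.norm_of_nonneg hε0.le, hε, div_mul_eq_mul_div, div_le_iff₀ hd]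
        gcongr
        linarith
      · exact AffineSubspace.vadd_mem_of_mem_direction (Submodule.smul_mem _ _
          (AffineSubspace.vsub_mem_direction (circumcenter_spec hs).1
            (mem_affineSpan ℝ (Finset.mem_coe.2 hp)))) (circumcenter_spec hs).1
    obtain ⟨u, hu0, hu1, huc⟩ := Finset.mem_convexHull'.1 hmem
    have hsing : ∑ q ∈ s, (Pi.single p ε : E n → ℝ) q = ε := by
      rw [Finset.sum_eq_single p]
      · simp
      · intro q _ hq; simp [hq]
      · intro h; exact absurd hp h
    have hsing' : ∑ q ∈ s, (Pi.single p ε : E n → ℝ) q • q = ε • p := by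
      rw [Finset.sum_eq_single p]
      · simp
      · intro q _ hq; simp [hq]
      · intro h; exact absurd hp h
    have h := weights_eq hs (w := fun q => (1 + ε) * w q)
      (v := fun q => u q + (Pi.single p ε : E n → ℝ) q)
      (by rw [← Finset.mul_sum, Finset.sum_add_distrib, hw1, hu1, hsing, mul_one])
      (by
        simp only [add_smul (u _), mul_smul]
        rw [← Finset.smul_sum, hwc, Finset.sum_add_distrib, huc, hsing', add_smul, one_smul,
          smul_sub]
        abel) p hp
    simp only [Pi.single_eq_same] at h
    have h0 := hu0 p hp
    have h1 : 0 < (1 + ε) * w p := by linarith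
    exact pos_of_mul_pos_right h1 (by positivity)
  refine ⟨fun p => if p ∈ s then w p else 0, ⟨fun p hp => by simp [hp, hpos], fun p hp => by simp [hp]⟩,
    ?_, ?_⟩
  · rw [← hw1]
    exact Finset.sum_congr rfl fun p hp => by simp [hp]
  · rw [← hwc]
    exact Finset.sum_congr rfl fun p hp => by simp [hp]

theorem subset_of_posOn_mem_convexHull {s t : Finset (E n)} (hs : s ∈ K.faces) (ht : t ∈ K.faces)
    {Q : E n → ℝ} (hQ : PosOn Q s) (hQ1 : ∑ p ∈ s, Q p = 1)
    (hmem : ∑ p ∈ s, Q p • p ∈ convexHull ℝ (t : Set (E n))) : s ⊆ t := by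
  classical
  have h1 : ∑ p ∈ s, Q p • p ∈ convexHull ℝ (s : Set (E n)) :=
    Finset.mem_convexHull'.2 ⟨Q, fun p _ => hQ.nonneg p, hQ1, rfl⟩
  have h2 := K.inter_subset_convexHull hs ht ⟨h1, hmem⟩
  rw [← Finset.coe_inter] at h2
  obtain ⟨u, hu0, hu1, huc⟩ := Finset.mem_convexHull'.1 h2
  have hsub : s ∩ t ⊆ s := Finset.inter_subset_left
  intro p hp
  by_contra hpt
  have h := weights_eq hs (w := Q) (v := fun q => if q ∈ s ∩ t then u q else 0)
    (by rw [hQ1, ← hu1, Finset.sum_ite_mem, Finset.inter_eq_right.2 hsub])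
    (by
      simp only [ite_smul, zero_smul]
      rw [← huc, Finset.sum_ite_mem, Finset.inter_eq_right.2 hsub]) p hp
  have := hQ.1 p hp
  rw [h] at this
  simp [hpt] at this

end Complex

/-! ### Points of affine simplices -/

theorem add_sum_smul_edges {n j : ℕ} (w : Fin (j + 1) → E n) (s : Fin j → ℝ) :
    w 0 + ∑ i, s i • edges w i =
      ∑ i, (Fin.cons (1 - ∑ i, s i) s : Fin (j + 1) → ℝ) i • w i := by
  rw [Fin.sum_univ_succ]
  simp only [edges, Fin.cons_zero, Fin.cons_succ, smul_sub, Finset.sum_sub_distrib]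
  rw [← Finset.sum_smul, sub_smul, one_smul]
  abel

theorem sum_cons_one_sub {j : ℕ} (s : Fin j → ℝ) :
    ∑ i, (Fin.cons (1 - ∑ i, s i) s : Fin (j + 1) → ℝ) i = 1 := by
  rw [Fin.sum_univ_succ]
  simp

theorem add_sum_smul_edges_mem {n j : ℕ} {w : Fin (j + 1) → E n} {A : Set (E n)}
    (hA : Convex ℝ A) (hw : ∀ i, w i ∈ A) {s : Fin j → ℝ} (hs : s ∈ cornerSimplex j 1) :
    w 0 + ∑ i, s i • edges w i ∈ A := by
  rw [add_sum_smul_edges]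
  refine hA.sum_mem (fun i _ => ?_) (sum_cons_one_sub s) fun i _ => hw i
  refine Fin.cases ?_ (fun i => ?_) i
  · simpa using hs.2
  · simpa using hs.1 i

theorem openCornerSimplex_subset (j : ℕ) : openCornerSimplex j ⊆ cornerSimplex j 1 :=
  fun _ h => ⟨fun i => (h.1 i).le, h.2.le⟩

namespace DualFlag

variable {k m : ℕ} {K : Geometry.SimplicialComplex ℝ (E (k + m))} {O : SimplexOrientation K}
  {τ : Simp K k}

theorem simp_natAdd_zero (F : DualFlag O τ) : (F.simp (Fin.natAdd k (0 : Fin (m + 1)))).1 = τ.1 := by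
  have h := F.lower (Fin.last k)
  have h2 : O.vert k τ '' Set.Iic (Fin.last k) = (τ.1 : Set (E (k + m))) := by
    rw [← O.range_vert k τ, ← Set.image_univ]
    congr 1
    ext i
    simp [Fin.le_last]
  rw [h2] at h
  exact Finset.coe_injective h

theorem piece_zero (F : DualFlag O τ) : F.piece 0 = circumcenter τ.1 :=
  congrArg circumcenter F.simp_natAdd_zero

theorem subset_last (F : DualFlag O τ) (i : Fin (k + m + 1)) :
    (F.simp i).1 ⊆ (F.simp (Fin.last (k + m))).1 := F.mono _ _ (Fin.le_last i)

theorem subset_natAdd (F : DualFlag O τ) (j : Fin (m + 1)) : τ.1 ⊆ (F.simp (Fin.natAdd k j)).1 := by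
  rw [← F.simp_natAdd_zero]
  exact F.mono _ _ (by simp [Fin.le_def])

theorem subset_simp_last (F : DualFlag O τ) : τ.1 ⊆ (F.simp (Fin.last (k + m))).1 :=
  F.subset_natAdd (Fin.last m)

theorem ext_upper {F F' : DualFlag O τ}
    (h : ∀ j : Fin (m + 1), (F.simp (Fin.natAdd k j)).1 = (F'.simp (Fin.natAdd k j)).1) : F = F' := by
  have hs : F.simp = F'.simp := by
    funext i
    refine Subtype.ext ?_
    by_cases hi : (i : ℕ) < k + 1
    · exact Finset.coe_injective ((F.lower ⟨i, hi⟩).trans (F'.lower ⟨i, hi⟩).symm)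
    · have := h ⟨i - k, by omega⟩
      have hi2 : (Fin.natAdd k (⟨i - k, by omega⟩ : Fin (m + 1)) : Fin (k + m + 1)) = i :=
        Fin.ext (by simp; omega)
      rw [hi2] at this
      exact this
  cases F
  cases F'
  cases hs
  rfl

theorem inner_edges_piece (F : DualFlag O τ) (i : Fin k) (j : Fin m) :
    inner ℝ (edges (O.vert k τ) i) (edges F.piece j) = (0 : ℝ) := by
  have hv : ∀ i, O.vert k τ i ∈ τ.1 := fun i => by
    rw [← Finset.mem_coe, ← O.range_vert k τ]
    exact Set.mem_range_self i
  have h := inner_sub_circumcenter_eq_zero τ.2.1 (F.simp (Fin.natAdd k j.succ)).2.1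
    (F.subset_natAdd _) (hv i.succ) (hv 0)
  rw [edges, edges, F.piece_zero]
  exact h

theorem piece_mem (hW : WellCentered K) (F : DualFlag O τ) (j : Fin (m + 1)) :
    F.piece j ∈ convexHull ℝ ((F.simp (Fin.last (k + m))).1 : Set (E (k + m))) :=
  circumcenter_mem_convexHull hW (F.simp _).2.1 (F.subset_last _)

theorem sum_smul_posOn {α : Type*} [AddCommGroup α] [Module ℝ α] {w : α → ℝ} {s t : Finset α}
    (h : PosOn w s) (hst : s ⊆ t) : ∑ p ∈ t, w p • p = ∑ p ∈ s, w p • p :=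
  (Finset.sum_subset hst fun p _ hp => by rw [h.2 p hp, zero_smul]).symm

theorem sum_posOn {α : Type*} {w : α → ℝ} {s t : Finset α} (h : PosOn w s) (hst : s ⊆ t) :
    ∑ p ∈ t, w p = ∑ p ∈ s, w p :=
  (Finset.sum_subset hst fun p _ hp => h.2 p hp).symm

/-- The relatively open dual simplices of distinct flags are disjoint. -/
theorem eq_of_sum_piece_eq (hW : WellCentered K) {F F' : DualFlag O τ} {β β' : Fin (m + 1) → ℝ}
    (hβ : ∀ j, 0 < β j) (hβ' : ∀ j, 0 < β' j) (hβ1 : ∑ j, β j = 1) (hβ1' : ∑ j, β' j = 1)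
    (h : ∑ j, β j • F.piece j = ∑ j, β' j • F'.piece j) : F = F' := by
  have hex : ∀ s : Finset (E (k + m)), ∃ w : E (k + m) → ℝ, s ∈ K.faces → PosOn w s ∧
      ∑ p ∈ s, w p = 1 ∧ ∑ p ∈ s, w p • p = circumcenter s := by
    intro s
    by_cases hs : s ∈ K.faces
    · obtain ⟨w, hw⟩ := exists_posOn_circumcenter hW hs
      exact ⟨w, fun _ => hw⟩
    · exact ⟨0, fun h => absurd h hs⟩
  choose W hWt using hex
  let A : DualFlag O τ → Fin (m + 1) → Finset (E (k + m)) := fun G j => (G.simp (Fin.natAdd k j)).1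
  have hf : ∀ G j, A G j ∈ K.faces := fun G j => (G.simp _).2.1
  have hmono : ∀ G, Monotone (A G) := fun G i j hij => 
    G.mono _ _ (show k + (i : ℕ) ≤ k + (j : ℕ) from Nat.add_le_add_left hij k)
  have hcard : ∀ G j, (A G j).card = k + 1 + j := fun G j => by
    rw [(G.simp _).2.2, Fin.val_natAdd]
    omega
  have hpos : ∀ G j, PosOn (W (A G j)) (A G j) := fun G j => (hWt _ (hf G j)).1
  have hQ : ∀ (G : DualFlag O τ) (γ : Fin (m + 1) → ℝ), (∀ j, 0 < γ j) → ∑ j, γ j = 1 →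
      PosOn (∑ j, γ j • W (A G j)) (A G (Fin.last m)) ∧
      ∑ p ∈ A G (Fin.last m), (∑ j, γ j • W (A G j)) p = 1 ∧
      ∑ p ∈ A G (Fin.last m), (∑ j, γ j • W (A G j)) p • p = ∑ j, γ j • G.piece j := by
    intro G γ hγ hγ1
    refine ⟨posOn_sum_chain (A G) _ (hpos G) (hmono G) γ hγ, ?_, ?_⟩
    · simp only [Finset.sum_apply, Pi.smul_apply, smul_eq_mul]
      rw [Finset.sum_comm, ← hγ1]
      refine Finset.sum_congr rfl fun j _ => ?_
      rw [← Finset.mul_sum, sum_posOn (hpos G j) (hmono G (Fin.le_last j)), (hWt _ (hf G j)).2.1,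
        mul_one]
    · simp only [Finset.sum_apply, Pi.smul_apply, smul_eq_mul, Finset.sum_smul, mul_smul]
      rw [Finset.sum_comm]
      refine Finset.sum_congr rfl fun j _ => ?_
      rw [← Finset.smul_sum, sum_smul_posOn (hpos G j) (hmono G (Fin.le_last j)),
        (hWt _ (hf G j)).2.2]
      rfl
  obtain ⟨h1, h2, h3⟩ := hQ F β hβ hβ1
  obtain ⟨h1', h2', h3'⟩ := hQ F' β' hβ' hβ1'
  have hmem := Finset.mem_convexHull'.2 ⟨_, fun p _ => h1.nonneg p, h2, rfl⟩
  have hmem' := Finset.mem_convexHull'.2 ⟨_, fun p _ => h1'.nonneg p, h2', rfl⟩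
  have hs : A F (Fin.last m) = A F' (Fin.last m) := by
    refine Finset.Subset.antisymm
      (subset_of_posOn_mem_convexHull (hf _ _) (hf _ _) h1 h2 ?_)
      (subset_of_posOn_mem_convexHull (hf _ _) (hf _ _) h1' h2' ?_)
    · rw [h3, h, ← h3']
      exact hmem'
    · rw [h3', ← h, ← h3]
      exact hmem
  rw [← hs] at h1' h2' h3'
  have hw := weights_eq (hf F (Fin.last m)) (h2.trans h2'.symm) (h3.trans (h.trans h3'.symm))
  have hQQ : ∑ j, β j • W (A F j) = ∑ j, β' j • W (A F' j) := by
    funext p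
    by_cases hp : p ∈ A F (Fin.last m)
    · exact hw p hp
    · rw [h1.2 p hp, h1'.2 p hp]
  exact ext_upper (congrFun (chain_eq_of_sum_eq W (k + 1) (A F) (A F') (hpos F) (hpos F') (hmono F)
    (hmono F') (hcard F) (hcard F') β β' hβ hβ' hQQ))

theorem eq_of_add_sum_edges_eq (hW : WellCentered K) {F F' : DualFlag O τ} {s s' : Fin m → ℝ}
    (hs : s ∈ openCornerSimplex m) (hs' : s' ∈ openCornerSimplex m)
    (h : F.piece 0 + ∑ i, s i • edges F.piece i = F'.piece 0 + ∑ i, s' i • edges F'.piece i) :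
    F = F' := by
  have hpos : ∀ s ∈ openCornerSimplex m, ∀ j,
      0 < (Fin.cons (1 - ∑ i, s i) s : Fin (m + 1) → ℝ) j := by
    intro s hs j
    refine Fin.cases ?_ (fun i => ?_) j
    · simpa using hs.2
    · simpa using hs.1 i
  rw [add_sum_smul_edges, add_sum_smul_edges] at h
  exact eq_of_sum_piece_eq hW (hpos s hs) (hpos s' hs') (sum_cons_one_sub s) (sum_cons_one_sub s') h

theorem piece_injective (hW : WellCentered K) :
    Function.Injective (DualFlag.piece : DualFlag O τ → Fin (m + 1) → E (k + m)) := by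
  intro F F' h
  obtain ⟨s, hs⟩ := openCornerSimplex_nonempty m
  exact eq_of_add_sum_edges_eq hW hs hs (by rw [h])

open MeasureTheory in
/-- The total volume of the dual simplices around `τ` is controlled by the mesh size. -/
theorem sum_abs_det_mul_volume_le (hK : K.faces.Finite) (hW : WellCentered K)
    [Fintype (DualFlag O τ)] (b : OrthonormalBasis (Fin k ⊕ Fin m) ℝ (E (k + m)))
    (hb : ∀ (F : DualFlag O τ) i j, inner ℝ (b (Sum.inl i)) (edges F.piece j) = (0 : ℝ)) :
    (∑ F : DualFlag O τ, |(coordSnd b (edges F.piece)).det|) *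
      volume.real (openCornerSimplex m) ≤ (2 * meshSize K) ^ m := by
  let M : DualFlag O τ → Matrix (Fin m) (Fin m) ℝ := fun F => coordSnd b (edges F.piece)
  let S : DualFlag O τ → Set (Fin m → ℝ) := fun F => (M F).toLin' '' openCornerSimplex m
  have hvec : ∀ F s, ∑ i, s i • edges F.piece i = ∑ j, ((M F).toLin' s) j • b (Sum.inr j) := by
    intro F s
    simp only [Matrix.toLin'_apply, Matrix.mulVec, dotProduct, Finset.sum_smul]
    rw [Finset.sum_comm]
    refine Finset.sum_congr rfl fun i _ => ?_
    rw [eq_sum_snd b (edges F.piece i) fun a => hb F a i, Finset.smul_sum]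
    refine Finset.sum_congr rfl fun j _ => ?_
    rw [smul_smul, mul_comm]
    rfl
  have hdisj : Set.PairwiseDisjoint (↑(Finset.univ : Finset (DualFlag O τ))) S := by
    intro F _ F' _ hne
    refine Set.disjoint_left.2 ?_
    rintro _ ⟨s, hs, rfl⟩ ⟨s', hs', h⟩
    refine hne (eq_of_add_sum_edges_eq hW hs hs' ?_)
    rw [hvec, hvec, h, F.piece_zero, F'.piece_zero]
  have hcube : ∀ F, S F ⊆ Set.Icc (fun _ => -meshSize K) fun _ => meshSize K := by
    rintro F _ ⟨s, hs, rfl⟩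
    have hy := add_sum_smul_edges_mem (convex_convexHull ℝ _) (F.piece_mem hW)
      (openCornerSimplex_subset m hs)
    have hd := dist_le_meshSize hK (F.simp _).2.1 hy (F.piece_mem hW 0)
    rw [dist_eq_norm, add_sub_cancel_left] at hd
    have hj : ∀ j, |(M F).toLin' s j| ≤ meshSize K := by
      intro j
      have h1 : inner ℝ (b (Sum.inr j)) (∑ i, s i • edges F.piece i) = (M F).toLin' s j := by
        rw [hvec, inner_sum]
        simp [inner_smul_right, b.inner_eq_ite]
      rw [← h1]
      refine (abs_real_inner_le_norm _ _).trans ?_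
      rwa [b.norm_eq_one, one_mul]
    exact ⟨fun j => (abs_le.1 (hj j)).1, fun j => (abs_le.1 (hj j)).2⟩
  have hopen : MeasurableSet (openCornerSimplex m) := (isOpen_openCornerSimplex m).measurableSet
  have hvol : ∀ F, volume (S F) =
      ENNReal.ofReal |(M F).det| * volume (openCornerSimplex m) := by
    intro F
    rw [Measure.addHaar_image_linearMap, LinearMap.det_toLin']
  have hmeas : ∀ F, NullMeasurableSet (S F) volume := by
    intro F
    by_cases hdet : (M F).det = 0
    · refine NullMeasurableSet.of_null ?_
      rw [hvol, hdet]
      simp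
    · have hinj : Function.Injective (M F).toLin' := by
        rw [← LinearMap.ker_eq_bot, LinearMap.ker_eq_bot']
        intro v hv
        rw [Matrix.toLin'_apply] at hv
        exact Matrix.eq_zero_of_mulVec_eq_zero hdet hv
      exact (hopen.image_of_continuousOn_injOn
        (LinearMap.continuous_of_finiteDimensional _).continuousOn hinj.injOn).nullMeasurableSet
  have hfin : volume (openCornerSimplex m) ≠ ⊤ :=
    ((measure_mono (openCornerSimplex_subset m)).trans_lt
      (isCompact_cornerSimplex m).measure_lt_top).ne
  have hsum : ∑ F, volume (S F) ≤ volume (Set.Icc (fun _ : Fin m => -meshSize K) fun _ => meshSize K) := by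
    rw [← measure_biUnion_finset₀ (fun F hF F' hF' h => (hdisj hF hF' h).aedisjoint)
      fun F _ => hmeas F]
    exact measure_mono (Set.iUnion₂_subset fun F _ => hcube F)
  rw [Real.volume_Icc_pi] at hsum
  have hh : 0 ≤ meshSize K := Real.sSup_nonneg (by
    rintro _ ⟨s, _, p, _, q, _, rfl⟩
    exact dist_nonneg)
  have h2 := ENNReal.toReal_mono (by simp) hsum
  rw [ENNReal.toReal_sum (fun F _ => by
    rw [hvol]; exact ENNReal.mul_ne_top ENNReal.ofReal_ne_top hfin), ENNReal.toReal_prod] at h2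
  simp only [hvol, ENNReal.toReal_mul, ENNReal.toReal_ofReal (abs_nonneg _)] at h2
  rw [← Finset.sum_mul] at h2
  refine h2.trans (le_of_eq ?_)
  rw [Finset.prod_const, Finset.card_univ, Fintype.card_fin, sub_neg_eq_add, ← two_mul,
    ENNReal.toReal_ofReal (by positivity)]

end DualFlag

theorem sum_sum_single_of_injective {ι α : Type*} [Fintype ι] {p : ι → α}
    (hp : Function.Injective p) (a : ι → ℤ) (φ : α → ℤ → ℝ) (hφ : ∀ x, φ x 0 = 0) :
    (∑ i, Finsupp.single (p i) (a i)).sum φ = ∑ i, φ (p i) (a i) := by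
  classical
  have hval : ∀ i, (∑ i, Finsupp.single (p i) (a i)) (p i) = a i := by
    intro i
    rw [Finsupp.finsetSum_apply, Finset.sum_eq_single i]
    · simp
    · intro j _ hj
      rw [Finsupp.single_apply, if_neg (hp.ne hj)]
    · simp
  have hsub : (∑ i, Finsupp.single (p i) (a i)).support ⊆ Finset.univ.image p := by
    intro x hx
    by_contra hn
    refine Finsupp.mem_support_iff.1 hx ?_
    rw [Finsupp.finsetSum_apply]
    refine Finset.sum_eq_zero fun i _ => ?_
    rw [Finsupp.single_apply, if_neg]
    rintro rfl
    exact hn (Finset.mem_image_of_mem _ (Finset.mem_univ i))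
  rw [Finsupp.sum_of_support_subset _ hsub _ fun x _ => hφ x, Finset.sum_image hp.injOn]
  simp only [hval]

section Bounds

variable {n k : ℕ} {K : Geometry.SimplicialComplex ℝ (E n)} {ω : Form n k}

theorem isCompact_space (hK : K.faces.Finite) : IsCompact K.space :=
  hK.isCompact_biUnion fun s _ => s.finite_toSet.isCompact_convexHull (𝕜 := ℝ)

theorem bddAbove_norm_fderiv (hK : K.faces.Finite) (hω : IsCr 1 K.space ω) :
    BddAbove ((fun x => ‖fderiv ℝ ω x‖) '' K.space) := by
  obtain ⟨U, hU, hKU, hd⟩ := hω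
  refine (isCompact_space hK).bddAbove_image ?_
  exact ((hd.continuousOn_fderiv_of_isOpen hU le_rfl).mono hKU).norm

theorem c1Seminorm_nonneg {Q : Set (E n)} : 0 ≤ c1Seminorm Q ω := by
  refine Real.sSup_nonneg ?_
  rintro _ ⟨x, _, rfl⟩
  exact norm_nonneg (fderiv ℝ ω x)

theorem meshSize_nonneg : 0 ≤ meshSize K := by
  refine Real.sSup_nonneg ?_
  rintro _ ⟨s, _, p, _, q, _, rfl⟩
  exact dist_nonneg

theorem norm_sub_le_c1Seminorm_mul_meshSize (hK : K.faces.Finite) (hω : IsCr 1 K.space ω)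
    {s : Finset (E n)} (hs : s ∈ K.faces) {x y : E n} (hx : x ∈ convexHull ℝ (s : Set (E n)))
    (hy : y ∈ convexHull ℝ (s : Set (E n))) :
    ‖ω x - ω y‖ ≤ c1Seminorm K.space ω * meshSize K := by
  have hb := bddAbove_norm_fderiv hK hω
  obtain ⟨U, hU, hKU, hd⟩ := hω
  have hsub := Geometry.SimplicialComplex.convexHull_subset_space hs
  refine ((convex_convexHull ℝ (s : Set (E n))).norm_image_sub_le_of_norm_fderiv_le (𝕜 := ℝ)
    (C := c1Seminorm K.space ω) (fun z hz => ?_) (fun z hz => ?_) hy hx).trans ?_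
  · exact (hd.differentiableOn one_ne_zero).differentiableAt (hU.mem_nhds (hKU (hsub hz)))
  · exact le_csSup hb ⟨z, hsub hz, rfl⟩
  · rw [← dist_eq_norm]
    exact mul_le_mul_of_nonneg_left (dist_le_meshSize hK hs hx hy) c1Seminorm_nonneg

/-- The mean over an affine simplex of the coefficient of `ω` along an orthonormal frame is close
to the coefficient at any point of the simplex. -/
theorem abs_factorial_mul_integral_form_sub_le (hK : K.faces.Finite) (hω : IsCr 1 K.space ω)
    {s : Finset (E n)} (hs : s ∈ K.faces) {j : ℕ} {w : Fin (j + 1) → E n}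
    (hw : ∀ i, w i ∈ convexHull ℝ (s : Set (E n))) {c : E n}
    (hc : c ∈ convexHull ℝ (s : Set (E n))) {t : Fin k → E n} (ht : ∀ i, ‖t i‖ = 1) :
    |(j.factorial : ℝ) * (∫ x in cornerSimplex j 1, ω (w 0 + ∑ i, x i • edges w i) t) - ω c t| ≤
      c1Seminorm K.space ω * meshSize K := by
  have hmem : ∀ x ∈ cornerSimplex j 1, w 0 + ∑ i, x i • edges w i ∈ convexHull ℝ (s : Set (E n)) :=
    fun x hx => add_sum_smul_edges_mem (convex_convexHull ℝ _) hw hx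
  refine abs_factorial_mul_integral_sub_le ?_ fun x hx => ?_
  · obtain ⟨U, hU, hKU, hd⟩ := hω
    have h1 : ContinuousOn (fun x : Fin j → ℝ => ω (w 0 + ∑ i, x i • edges w i))
        (cornerSimplex j 1) := by
      refine hd.continuousOn.comp (Continuous.continuousOn (by fun_prop)) fun x hx => ?_
      exact hKU (Geometry.SimplicialComplex.convexHull_subset_space hs (hmem x hx))
    exact (continuous_eval_const t).comp_continuousOn h1
  · rw [← ContinuousAlternatingMap.sub_apply, ← Real.norm_eq_abs]
    refine (ContinuousAlternatingMap.le_opNorm _ _).trans ?_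
    simp only [ht, Finset.prod_const_one, mul_one]
    exact norm_sub_le_c1Seminorm_mul_meshSize hK hω hs (hmem x hx) hc

end Bounds

/-! ### Simplex integrals and volumes in adapted coordinates -/

section Coordinates

variable {k m : ℕ} (b : OrthonormalBasis (Fin k ⊕ Fin m) ℝ (E (k + m)))

theorem det_inner_fst (x y : Fin k → E (k + m))
    (hx : ∀ i j, inner ℝ (b (Sum.inr i)) (x j) = (0 : ℝ))
    (hy : ∀ i j, inner ℝ (b (Sum.inr i)) (y j) = (0 : ℝ)) :
    Matrix.det (Matrix.of fun a c => inner ℝ (x a) (y c)) =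
      (coordFst b x).det * (coordFst b y).det :=
  det_inner_eq_mul (b.orthonormal.comp _ Sum.inl_injective) x y _ _
    (fun j => eq_sum_fst b (x j) fun i => hx i j) fun j => eq_sum_fst b (y j) fun i => hy i j

theorem simplexVolume_fst (w : Fin (k + 1) → E (k + m))
    (hw : ∀ i j, inner ℝ (b (Sum.inr i)) (edges w j) = (0 : ℝ)) :
    simplexVolume w = |(coordFst b (edges w)).det| / k.factorial := by
  rw [simplexVolume, det_inner_fst b _ _ hw hw, Real.sqrt_mul_self_eq_abs]

theorem simplexVolume_snd (w : Fin (m + 1) → E (k + m))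
    (hw : ∀ i j, inner ℝ (b (Sum.inl i)) (edges w j) = (0 : ℝ)) :
    simplexVolume w = |(coordSnd b (edges w)).det| / m.factorial := by
  rw [simplexVolume, det_inner_eq_mul (b.orthonormal.comp _ Sum.inr_injective) _ _
    (coordSnd b (edges w)) (coordSnd b (edges w))
    (fun j => eq_sum_snd b _ fun i => hw i j) fun j => eq_sum_snd b _ fun i => hw i j,
    Real.sqrt_mul_self_eq_abs]

theorem simplexIntegral_fst (ω : Form (k + m) k) (w : Fin (k + 1) → E (k + m))
    (hw : ∀ i j, inner ℝ (b (Sum.inr i)) (edges w j) = (0 : ℝ)) :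
    simplexIntegral ω w = (coordFst b (edges w)).det *
      ∫ x in cornerSimplex k 1, ω (w 0 + ∑ i, x i • edges w i) fun i => b (Sum.inl i) := by
  rw [← MeasureTheory.integral_const_mul]
  exact MeasureTheory.integral_congr_ae (Filter.Eventually.of_forall fun x =>
    alternatingMap_eq_det_mul (ω _).toAlternatingMap _ _ _ fun j =>
      eq_sum_fst b _ fun i => hw i j)

theorem simplexIntegral_star_snd (o : Orientation ℝ (E (k + m)) (Fin (k + m)))
    (ω : Form (k + m) k) (w : Fin (m + 1) → E (k + m))
    (hw : ∀ i j, inner ℝ (b (Sum.inl i)) (edges w j) = (0 : ℝ)) :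
    simplexIntegral (star o ω) w = (coordSnd b (edges w)).det * splitSign b o *
      ∫ x in cornerSimplex m 1, ω (w 0 + ∑ i, x i • edges w i) fun i => b (Sum.inl i) := by
  rw [← MeasureTheory.integral_const_mul]
  refine MeasureTheory.integral_congr_ae (Filter.Eventually.of_forall fun x => ?_)
  have h := alternatingMap_eq_det_mul
    (star o ω (w 0 + ∑ i, x i • edges w i)).toAlternatingMap _ (edges w) (coordSnd b (edges w))
    fun j => eq_sum_snd b _ fun i => hw i j
  simp only [ContinuousAlternatingMap.coe_toAlternatingMap] at h
  simp only [h]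
  rw [star, starCovector_apply_snd, mul_assoc]

end Coordinates

namespace DualFlag

variable {k m : ℕ} {K : Geometry.SimplicialComplex ℝ (E (k + m))} {O : SimplexOrientation K}
  {τ : Simp K k}

/-- The circumcenters of the part of the flag up to `τ`. -/
def lowerCenters (F : DualFlag O τ) : Fin (k + 1) → E (k + m) :=
  fun i => F.centers (Fin.castLE (by omega) i)

theorem edges_mem_direction (i : Fin k) :
    edges (O.vert k τ) i ∈ vectorSpan ℝ (τ.1 : Set (E (k + m))) := by
  rw [← O.range_vert k τ]
  exact vsub_mem_vectorSpan ℝ (Set.mem_range_self _) (Set.mem_range_self _)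

theorem span_edges : Submodule.span ℝ (Set.range (edges (O.vert k τ))) =
    vectorSpan ℝ (τ.1 : Set (E (k + m))) := by
  refine le_antisymm (Submodule.span_le.2 ?_) ?_
  · rintro _ ⟨i, rfl⟩
    exact edges_mem_direction i
  · rw [← O.range_vert k τ, vectorSpan_range_eq_span_range_vsub_right ℝ _ 0]
    refine Submodule.span_le.2 ?_
    rintro _ ⟨i, rfl⟩
    refine Fin.cases ?_ (fun i => ?_) i
    · simp
    · exact Submodule.subset_span ⟨i, rfl⟩

theorem linearIndependent_edges : LinearIndependent ℝ (edges (O.vert k τ)) := by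
  rw [linearIndependent_iff_card_eq_finrank_span, Set.finrank, span_edges]
  have h := (K.indep τ.2.1).finrank_vectorSpan (n := k) (by simpa using τ.2.2)
  rw [Subtype.range_coe_subtype] at h
  simpa using h.symm

theorem edges_lowerCenters_mem (F : DualFlag O τ) (i : Fin k) :
    edges F.lowerCenters i ∈ vectorSpan ℝ (τ.1 : Set (E (k + m))) := by
  have h : ∀ j : Fin (k + 1), F.lowerCenters j ∈ affineSpan ℝ (τ.1 : Set (E (k + m))) := by
    intro j
    have hj := (circumcenter_spec (F.simp (Fin.castLE (by omega) j)).2.1).1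
    refine affineSpan_mono ℝ ?_ hj
    rw [F.lower j, ← O.range_vert k τ]
    exact Set.image_subset_range _ _
  rw [← direction_affineSpan]
  exact AffineSubspace.vsub_mem_direction (h _) (h _)

theorem lowerCenters_last (F : DualFlag O τ) : F.lowerCenters (Fin.last k) = F.piece 0 := rfl

theorem sgn_eq {o : Orientation ℝ (E (k + m)) (Fin (k + m))} (hO : O.TopPositive o)
    (b : OrthonormalBasis (Fin k ⊕ Fin m) ℝ (E (k + m)))
    (hb : ∀ x ∈ vectorSpan ℝ (τ.1 : Set (E (k + m))), ∀ j, inner ℝ (b (Sum.inr j)) x = (0 : ℝ))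
    (F : DualFlag O τ) :
    (F.sgn : ℤ) = (SignType.sign ((coordFst b (edges F.lowerCenters)).det *
        (coordFst b (edges (O.vert k τ))).det) : ℤ) *
      (SignType.sign ((coordFst b (edges F.lowerCenters)).det *
        (coordSnd b (edges F.piece)).det * splitSign b o) : ℤ) := by
  have hlow : ∀ i j, inner ℝ (b (Sum.inr i)) (edges F.lowerCenters j) = (0 : ℝ) :=
    fun i j => hb _ (F.edges_lowerCenters_mem j) i
  have h1 : relSign F.lowerCenters (O.vert k τ) = (SignType.sign
      ((coordFst b (edges F.lowerCenters)).det * (coordFst b (edges (O.vert k τ))).det) : ℤ) := by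
    rw [relSign, det_inner_fst b _ _ hlow fun i j => hb _ (edges_mem_direction j) i]
  let e : Fin m → E (k + m) := fun j => F.piece j.succ - F.lowerCenters 0
  have happ : edges F.centers = Fin.append (edges F.lowerCenters) e := by
    ext1 j
    refine Fin.addCases (fun a => ?_) (fun a => ?_) j
    · rw [Fin.append_left]
      rfl
    · rw [Fin.append_right]
      rfl
  have he : coordSnd b e = coordSnd b (edges F.piece) := by
    ext i j
    have hz : inner ℝ (b (Sum.inr i)) (F.lowerCenters (Fin.last k) - F.lowerCenters 0) = (0 : ℝ) := by
      rcases Nat.eq_zero_or_pos k with rfl | hk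
      · have : Fin.last 0 = 0 := rfl
        rw [this, sub_self, inner_zero_right]
      · obtain ⟨k', rfl⟩ := Nat.exists_eq_succ_of_ne_zero hk.ne'
        exact hlow i (Fin.last k')
    rw [lowerCenters_last] at hz
    simp only [coordSnd, Matrix.of_apply, edges, e]
    rw [← sub_add_sub_cancel _ (F.piece 0), inner_add_right, hz, add_zero]
  have h2 : relSign F.centers (O.vert (k + m) (F.simp (Fin.last (k + m)))) =
      (SignType.sign ((coordFst b (edges F.lowerCenters)).det *
        (coordSnd b (edges F.piece)).det * splitSign b o) : ℤ) := by
    rw [relSign, det_inner_eq_volumeForm_mul o, sign_mul,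
      sign_pos (hO (F.simp (Fin.last (k + m)))), mul_one, happ,
      volumeForm_append_of_fst_orthogonal b o _ _ hlow, he]
  rw [← h1, ← h2]
  rfl

end DualFlag

theorem abs_sign_eq_one {x : ℝ} (hx : x ≠ 0) : |((SignType.sign x : ℤ) : ℝ)| = 1 := by
  rcases lt_or_gt_of_ne hx with h | h <;> simp [h]

theorem sign_mul_eq_abs (x : ℝ) : ((SignType.sign x : ℤ) : ℝ) * x = |x| := by
  rcases lt_trichotomy x 0 with h | h | h
  · simp [h, abs_of_neg h]
  · simp [h]
  · simp [h, abs_of_pos h]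

/-- The contribution of one dual simplex to the consistency error. -/
theorem abs_sub_le_of_sign {A G D v I J P Q a R : ℝ} (hG : G ≠ 0) (hv : |v| = 1) (hP : 0 < P)
    (hQ : 0 < Q) (hI : |P * I - a| ≤ R) (hJ : |Q * J - a| ≤ R) {s : ℤ}
    (hs : s = (SignType.sign (A * G) : ℤ) * (SignType.sign (A * D * v) : ℤ)) :
    |(|(s : ℝ)| * (|D| / Q)) / (|G| / P) * (G * I) - s * (D * v * J)| ≤ |D| / Q * (2 * R) := by
  have hR : 0 ≤ R := (abs_nonneg _).trans hI
  have hrhs : 0 ≤ |D| / Q * (2 * R) := by positivity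
  by_cases hA : A = 0
  · simp [hs, hA, hrhs]
  by_cases hD : D = 0
  · simp [hD]
  have hv0 : v ≠ 0 := by rintro rfl; simp at hv
  have hs' : (s : ℝ) = (SignType.sign A : ℤ) * (SignType.sign A : ℤ) *
      ((SignType.sign G : ℤ) * (SignType.sign D : ℤ) * (SignType.sign v : ℤ)) := by
    rw [hs]
    simp only [sign_mul]
    push_cast
    ring
  have hAA : (((SignType.sign A : ℤ) : ℝ)) * (SignType.sign A : ℤ) = 1 := by
    rw [← abs_mul_abs_self, abs_sign_eq_one hA, one_mul]
  rw [hAA, one_mul] at hs'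
  have hsabs : |(s : ℝ)| = 1 := by
    rw [hs', abs_mul, abs_mul, abs_sign_eq_one hG, abs_sign_eq_one hD, abs_sign_eq_one hv0]
    norm_num
  have hGG : G = (SignType.sign G : ℤ) * |G| := by
    have h1 := sign_mul_eq_abs G
    have h2 : (((SignType.sign G : ℤ) : ℝ)) * (SignType.sign G : ℤ) = 1 := by
      rw [← abs_mul_abs_self, abs_sign_eq_one hG, one_mul]
    rw [← h1, ← mul_assoc, h2, one_mul]
  have hG0 : |G| ≠ 0 := abs_ne_zero.2 hG
  have key : (|(s : ℝ)| * (|D| / Q)) / (|G| / P) * (G * I) - s * (D * v * J) =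
      (SignType.sign G : ℤ) * (|D| / Q) * ((P * I - a) - (Q * J - a)) := by
    have e1 : (s : ℝ) * (D * v * J) = (SignType.sign G : ℤ) * |D| * J := by
      rw [hs']
      have h1 := sign_mul_eq_abs D
      have h2 := sign_mul_eq_abs v
      rw [hv] at h2
      rw [← h1]
      linear_combination ((SignType.sign G : ℤ) : ℝ) * (SignType.sign D : ℤ) * D * J * h2
    have e2 : (|(s : ℝ)| * (|D| / Q)) / (|G| / P) * (G * I) =
        (SignType.sign G : ℤ) * (|D| / Q) * (P * I) := by
      rw [hsabs]
      conv_lhs => enter [2, 1]; rw [hGG]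
      field_simp
    rw [e1, e2]
    field_simp
    ring
  rw [key, abs_mul, abs_mul, abs_sign_eq_one hG, one_mul, abs_of_nonneg (by positivity : 0 ≤ |D| / Q)]
  refine mul_le_mul_of_nonneg_left ?_ (by positivity)
  refine (abs_sub _ _).trans ?_
  linarith

end DEC

end

theorem mainTheorem2 (k m : ℕ) :
    ∃ C : ℝ, ∀ (o : Orientation ℝ (DEC.E (k + m)) (Fin (k + m)))
      (K : Geometry.SimplicialComplex ℝ (DEC.E (k + m))) (O : DEC.SimplexOrientation K),
      K.faces.Finite → DEC.WellCentered K → O.TopPositive o →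
      ∀ (σ : DEC.Simp K (k + m)) (τ : DEC.Simp K k), τ.1 ⊆ σ.1 →
      ∀ ω : DEC.Form (k + m) k, DEC.IsCr 1 K.space ω →
        |(DEC.discreteStar O (DEC.deRham O ω)).evalDual τ
            - (DEC.deRhamDual O (DEC.star o ω)).evalDual τ|
          ≤ C * DEC.c1Seminorm K.space ω *
              (DEC.meshSize K ^ (k + m + 1) / DEC.inradius τ.1 ^ k) := by
  set c := MeasureTheory.volume.real (DEC.openCornerSimplex m) with hc
  have hcpos : 0 < c := by
    refine ENNReal.toReal_pos ((DEC.isOpen_openCornerSimplex m).measure_pos _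
      (DEC.openCornerSimplex_nonempty m)).ne' ?_
    exact ((MeasureTheory.measure_mono (DEC.openCornerSimplex_subset m)).trans_lt
      (DEC.isCompact_cornerSimplex m).measure_lt_top).ne
  refine ⟨2 ^ m / c / m.factorial * 2, fun o K O hK hW hO σ τ _ ω hω => ?_⟩
  have := DEC.finite_dualFlag hK O τ
  let _ : Fintype (DEC.DualFlag O τ) := Fintype.ofFinite _
  obtain ⟨b, hb1, hb2⟩ := DEC.exists_split_orthonormalBasis _
    (DEC.DualFlag.linearIndependent_edges (O := O) (τ := τ))
  rw [DEC.DualFlag.span_edges] at hb1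
  have hfst : ∀ i j, inner ℝ (b (Sum.inr i)) (DEC.edges (O.vert k τ) j) = (0 : ℝ) :=
    fun i j => hb1 _ (DEC.DualFlag.edges_mem_direction j) i
  have hsnd : ∀ (F : DEC.DualFlag O τ) i j,
      inner ℝ (b (Sum.inl i)) (DEC.edges F.piece j) = (0 : ℝ) :=
    fun F i j => hb2 _ (fun a => F.inner_edges_piece a j) i
  set L := DEC.c1Seminorm K.space ω with hL
  set h := DEC.meshSize K with hh
  have hL0 : 0 ≤ L := DEC.c1Seminorm_nonneg
  have hh0 : 0 ≤ h := DEC.meshSize_nonneg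
  set G := (DEC.coordFst b (DEC.edges (O.vert k τ))).det with hGdef
  have hG : G ≠ 0 := by
    intro hG
    have h1 := DEC.det_inner_fst b _ _ hfst hfst
    rw [← hGdef, hG, mul_zero] at h1
    exact ((Matrix.posDef_gram_of_linearIndependent
      (DEC.DualFlag.linearIndependent_edges (O := O) (τ := τ))).det_pos).ne' h1
  have hvert : ∀ i, O.vert k τ i ∈ convexHull ℝ (τ.1 : Set (DEC.E (k + m))) := fun i => by
    refine subset_convexHull ℝ _ ?_
    rw [← O.range_vert k τ]
    exact Set.mem_range_self i
  have hnorm : ∀ i, ‖b (Sum.inl i)‖ = 1 := fun i => b.norm_eq_one _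
  have hlhs : (DEC.discreteStar O (DEC.deRham O ω)).evalDual τ
      - (DEC.deRhamDual O (DEC.star o ω)).evalDual τ =
      ∑ F : DEC.DualFlag O τ, ((|(F.sgn : ℝ)| * DEC.simplexVolume F.piece) /
        DEC.simplexVolume (O.vert k τ) * DEC.simplexIntegral ω (O.vert k τ) -
        F.sgn * DEC.simplexIntegral (DEC.star o ω) F.piece) := by
    have e1 : (DEC.discreteStar O (DEC.deRham O ω)).evalDual τ =
        DEC.chainVolume (DEC.dualCell O τ) / DEC.simplexVolume (O.vert k τ) *
          DEC.simplexIntegral ω (O.vert k τ) :=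
      (DEC.Cochain.eval_ofValues _ τ).trans (congrArg _ (DEC.Cochain.eval_ofValues _ τ))
    have e2 : (DEC.deRhamDual O (DEC.star o ω)).evalDual τ =
        DEC.chainIntegral (DEC.star o ω) (DEC.dualCell O τ) := DEC.Cochain.eval_ofValues _ τ
    have hcell : DEC.dualCell O τ = ∑ F : DEC.DualFlag O τ, Finsupp.single F.piece F.sgn :=
      finsum_eq_sum_of_fintype _
    rw [e1, e2, DEC.chainVolume, DEC.chainIntegral, hcell,
      DEC.sum_sum_single_of_injective (DEC.DualFlag.piece_injective hW) _ _ (by simp),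
      DEC.sum_sum_single_of_injective (DEC.DualFlag.piece_injective hW) _ _ (by simp),
      Finset.sum_sub_distrib, Finset.sum_div, Finset.sum_mul]
  have hterm : ∀ F : DEC.DualFlag O τ, |(|(F.sgn : ℝ)| * DEC.simplexVolume F.piece) /
        DEC.simplexVolume (O.vert k τ) * DEC.simplexIntegral ω (O.vert k τ) -
        F.sgn * DEC.simplexIntegral (DEC.star o ω) F.piece| ≤
      |(DEC.coordSnd b (DEC.edges F.piece)).det| / m.factorial * (2 * (L * h)) := by
    intro F
    rw [DEC.simplexVolume_fst b _ hfst, DEC.simplexVolume_snd b _ (hsnd F),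
      DEC.simplexIntegral_fst b _ _ hfst, DEC.simplexIntegral_star_snd b o _ _ (hsnd F)]
    exact DEC.abs_sub_le_of_sign hG (DEC.abs_splitSign b o) (by positivity) (by positivity)
      (DEC.abs_factorial_mul_integral_form_sub_le hK hω τ.2.1 hvert
        (DEC.circumcenter_mem_convexHull hW τ.2.1 subset_rfl) hnorm)
      (DEC.abs_factorial_mul_integral_form_sub_le hK hω (F.simp (Fin.last (k + m))).2.1
        (F.piece_mem hW) (DEC.circumcenter_mem_convexHull hW τ.2.1 F.subset_simp_last) hnorm)
      (F.sgn_eq hO b hb1)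
  have hvol := DEC.DualFlag.sum_abs_det_mul_volume_le hK hW b hsnd
  rw [← hc, ← hh, ← le_div_iff₀ hcpos] at hvol
  have hratio : h ^ (m + 1) ≤ h ^ (k + m + 1) / DEC.inradius τ.1 ^ k := by
    rcases Nat.eq_zero_or_pos k with hk | hk
    · subst hk
      simp
    · obtain ⟨p, hp, q, hq, hpq⟩ := Finset.one_lt_card.1 (show 1 < τ.1.card by rw [τ.2.2]; omega)
      obtain ⟨h1, h2⟩ := DEC.inradius_bounds hK hW τ.2.1 hp hq hpq
      rw [le_div_iff₀ (by positivity), add_assoc, pow_add h k, mul_comm]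
      gcongr
  rw [hlhs]
  calc _ ≤ ∑ F : DEC.DualFlag O τ,
        |(DEC.coordSnd b (DEC.edges F.piece)).det| / m.factorial * (2 * (L * h)) :=
        (Finset.abs_sum_le_sum_abs _ _).trans (Finset.sum_le_sum fun F _ => hterm F)
    _ = (∑ F : DEC.DualFlag O τ, |(DEC.coordSnd b (DEC.edges F.piece)).det|) / m.factorial *
        (2 * (L * h)) := by rw [Finset.sum_div, Finset.sum_mul]
    _ ≤ (2 * h) ^ m / c / m.factorial * (2 * (L * h)) := by gcongr
    _ = 2 ^ m / c / m.factorial * 2 * L * h ^ (m + 1) := by ring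
    _ ≤ _ := by gcongr
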